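/- Let $X$ be a real locally convex topological vector space whose $\sigma$-algebra is generated by the continuous linear functionals and is standard Borel (if $X$ is a Hausdorff Souslin space, for instance a separable Fréchet space or $\mathcal D'(S^1)$, this $\sigma$-algebra is the Borel $\sigma$-algebra). A Gaussian measure on such a space is a (probability) measure whose image under every continuous linear functional is a, possibly degenerate, Gaussian measure on $\mathbb R$. A measure class is the set of all $\sigma$-finite positive measures that have the same null sets as a given one; $\mathcal C\otimes\mathcal C$ is the measure class on $X\times X$ containing $\mu\times\mu$ for $\mu\in\mathcal C$. The space $\mathcal H(\mathcal C)$ of half-densities consists of the families $\delta=(\delta_\mu)_{\mu\in\mathcal C}$, $\delta_\mu\in L^2(X,\mu;\mathbb R)$, with $\delta_\mu=\delta_\nu\,(d\nu/d\mu)^{1/2}$ for all $\mu,\nu\in\mathcal C$ (one writes $\delta=\delta_\mu(d\mu)^{1/2}$). A finite measure $\nu\in\mathcal C$ has the positive square root $\nu^{1/2}\in\mathcal H(\mathcal C)$ with $(\nu^{1/2})_\mu=(d\nu/d\mu)^{1/2}$. For a finite measure $\nu\in\mathcal C\otimes\mathcal C$, the half-density $\nu^{1/2}\in\mathcal H(\mathcal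 C\otimes\mathcal C)$ acts as the operator on $\mathcal H(\mathcal C)$ given by $(\nu^{1/2}\delta)_\mu(\phi)=\int(\nu^{1/2})_{\mu\times\mu}(\phi,\eta)\,\delta_\mu(\eta)\,d\mu(\eta)$, $\mu\in\mathcal C$. Let $\mathcal C$ be a measure class on $X$ that contains a Gaussian measure, and let $\nu_1,\nu_2$ be Gaussian measures on $X\times X$ that belong to $\mathcal C\otimes\mathcal C$. Then there is a finite measure $\nu_3\in\mathcal C\otimes\mathcal C$ such that $\nu_1^{1/2}\circ\nu_2^{1/2}=\nu_3^{1/2}$ as operators on $\mathcal H(\mathcal C)$ and $$\nu_3(\phi,\psi)=\Big(\int_\eta\nu_1(\phi,\eta)^{1/2}\,\nu_2(\eta,\psi)^{1/2}\Big)^2,$$ that is, for every $\mu\in\mathcal C$ and $(\mu\times\mu)$-almost every $(\phi,\psi)$, $$\frac{d\nu_3}{d(\mu\times\mu)}(\phi,\psi)=\Big(\int_X\Big(\frac{d\nu_1}{d(\mu\times\mu)}(\phi,\eta)\Big)^{1/2}\Big(\frac{d\nu_2}{d(\mu\times\mu)}(\eta,\psi)\Big)^{1/2}d\mu(\eta)\Big)^2;$$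 and every such $\nu_3$ is of the form $\nu_3=c\,G$ with a real constant $c>0$ and a Gaussian measure $G$ on $X\times X$. -/

import Mathlib

open MeasureTheory ProbabilityTheory
open scoped ENNReal NNReal

noncomputable section

namespace HalfDensities

/-- The `σ`-algebra of a topological vector space that is generated by its continuous linear
functionals. -/
abbrev cylinderSigmaAlgebra (X : Type*) [AddCommGroup X] [Module ℝ X] [TopologicalSpace X] :
    MeasurableSpace X :=
  ⨆ L : StrongDual ℝ X, MeasurableSpace.comap (fun x => L x) (borel ℝ)

/-- A measure class: all (positive) `σ`-finite measures having the same null sets as a given one. -/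
structure MeasureClass (X : Type*) [MeasurableSpace X] where
  carrier : Set (Measure X)
  exists_rep : ∃ μ : Measure X, SigmaFinite μ ∧
    carrier = {ν | SigmaFinite ν ∧ ν ≪ μ ∧ μ ≪ ν}

namespace MeasureClass

variable {X Y : Type*} [MeasurableSpace X] [MeasurableSpace Y]

instance : Membership (Measure X) (MeasureClass X) := ⟨fun 𝒞 μ => μ ∈ 𝒞.carrier⟩

/-- The measure class of a `σ`-finite measure. -/
def of (μ : Measure X) [SigmaFinite μ] : MeasureClass X :=
  ⟨{ν | SigmaFinite ν ∧ ν ≪ μ ∧ μ ≪ ν}, μ, inferInstance, rfl⟩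

theorem sigmaFinite {𝒞 : MeasureClass X} {μ : Measure X} (h : μ ∈ 𝒞) : SigmaFinite μ := by
  obtain ⟨ρ, -, hρ⟩ := 𝒞.exists_rep
  change μ ∈ 𝒞.carrier at h
  rw [hρ] at h
  exact h.1

theorem ac {𝒞 : MeasureClass X} {μ ν : Measure X} (hμ : μ ∈ 𝒞) (hν : ν ∈ 𝒞) : μ ≪ ν := by
  obtain ⟨ρ, -, hρ⟩ := 𝒞.exists_rep
  change μ ∈ 𝒞.carrier at hμ
  change ν ∈ 𝒞.carrier at hν
  rw [hρ] at hμ hν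
  exact hμ.2.1.trans hν.2.2

/-- The positive representatives of a measure class. -/
abbrev Rep (𝒞 : MeasureClass X) : Type _ := {μ : Measure X // μ ∈ 𝒞}

instance (𝒞 : MeasureClass X) (μ : 𝒞.Rep) : SigmaFinite (μ : Measure X) := sigmaFinite μ.2

/-- The measure class `𝒞 ⊗ 𝒟` on the product, generated by the products `μ × ν` with
`μ ∈ 𝒞` and `ν ∈ 𝒟`. -/
def tensor (𝒞 : MeasureClass X) (𝒟 : MeasureClass Y) : MeasureClass (X × Y) where
  carrier := {κ | SigmaFinite κ ∧ ∃ μ ∈ 𝒞, ∃ ν ∈ 𝒟, κ ≪ μ.prod ν ∧ μ.prod ν ≪ κ}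
  exists_rep := by
    obtain ⟨μ₀, h₀, e₀⟩ := 𝒞.exists_rep
    obtain ⟨ν₀, k₀, f₀⟩ := 𝒟.exists_rep
    have hμ₀ : μ₀ ∈ 𝒞 := by
      change μ₀ ∈ 𝒞.carrier
      rw [e₀]; exact ⟨h₀, .rfl, .rfl⟩
    have hν₀ : ν₀ ∈ 𝒟 := by
      change ν₀ ∈ 𝒟.carrier
      rw [f₀]; exact ⟨k₀, .rfl, .rfl⟩
    refine ⟨μ₀.prod ν₀, inferInstance, Set.ext fun κ => and_congr_right fun _ => ⟨?_, ?_⟩⟩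
    · rintro ⟨μ, hμ, ν, hν, h, h'⟩
      have := sigmaFinite hν
      exact ⟨h.trans ((ac hμ hμ₀).prod (ac hν hν₀)), ((ac hμ₀ hμ).prod (ac hν₀ hν)).trans h'⟩
    · rintro ⟨h, h'⟩
      exact ⟨μ₀, hμ₀, ν₀, hν₀, h, h'⟩

/-- The product of two representatives, as a representative of the tensor product. -/
def Rep.prod {𝒞 : MeasureClass X} {𝒟 : MeasureClass Y} (μ : 𝒞.Rep) (ν : 𝒟.Rep) :
    (𝒞.tensor 𝒟).Rep :=
  ⟨μ.1.prod ν.1, inferInstance, μ.1, μ.2, ν.1, ν.2, .rfl, .rfl⟩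

end MeasureClass

open MeasureClass

variable {X : Type*} [MeasurableSpace X]

/-- The positive square root `(dν/dμ)^{1/2}`. -/
def sqrtDeriv (ν μ : Measure X) (x : X) : ℝ := √(ν.rnDeriv μ x).toReal

theorem measurable_sqrtDeriv (ν μ : Measure X) : Measurable (sqrtDeriv ν μ) :=
  (Measure.measurable_rnDeriv ν μ).ennreal_toReal.sqrt

theorem sqrtDeriv_mul (ν ρ μ : Measure X) [SigmaFinite ν] [SigmaFinite ρ] [SigmaFinite μ]
    (h : ν ≪ ρ) :
    sqrtDeriv ν μ =ᵐ[μ] fun x => sqrtDeriv ν ρ x * sqrtDeriv ρ μ x := by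
  filter_upwards [Measure.rnDeriv_mul_rnDeriv (κ := μ) h] with x hx
  simp only [sqrtDeriv, ← hx, Pi.mul_apply, ENNReal.toReal_mul]
  exact Real.sqrt_mul ENNReal.toReal_nonneg _

theorem sqrtDeriv_prod (ν μ : Measure X) [SigmaFinite ν] [SigmaFinite μ] (h : ν ≪ μ) :
    sqrtDeriv (ν.prod ν) (μ.prod μ) =ᵐ[μ.prod μ]
      fun p => sqrtDeriv ν μ p.1 * sqrtDeriv ν μ p.2 := by
  have e : ν.prod ν =
      (μ.prod μ).withDensity (fun p => ν.rnDeriv μ p.1 * ν.rnDeriv μ p.2) := by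
    have : SigmaFinite (μ.withDensity (ν.rnDeriv μ)) := by
      rw [Measure.withDensity_rnDeriv_eq _ _ h]; infer_instance
    rw [← prod_withDensity (Measure.measurable_rnDeriv ν μ) (Measure.measurable_rnDeriv ν μ),
      Measure.withDensity_rnDeriv_eq _ _ h]
  have key : (ν.prod ν).rnDeriv (μ.prod μ) =ᵐ[μ.prod μ]
      fun p => ν.rnDeriv μ p.1 * ν.rnDeriv μ p.2 := by
    conv_lhs => rw [e]
    exact Measure.rnDeriv_withDensity _ (((Measure.measurable_rnDeriv ν μ).comp measurable_fst).mul
      ((Measure.measurable_rnDeriv ν μ).comp measurable_snd))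
  filter_upwards [key] with p hp
  simp only [sqrtDeriv, hp, ENNReal.toReal_mul]
  exact Real.sqrt_mul ENNReal.toReal_nonneg _

/-- The space `ℋ(𝒞)` of half-densities relative to the measure class `𝒞`. A half-density `δ` is
given by its coordinates `δ_μ ∈ L²(X, μ; ℝ)`, one for each representative `μ` of `𝒞`, where
`δ = δ_μ (dμ)^{1/2} = δ_ν (dν)^{1/2}`, that is, `δ_μ = δ_ν (dν/dμ)^{1/2}`. -/
def HalfDensity (𝒞 : MeasureClass X) : Submodule ℝ (∀ μ : 𝒞.Rep, Lp ℝ 2 (μ : Measure X)) where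
  carrier := {δ | ∀ μ ν : 𝒞.Rep, δ μ =ᵐ[μ.1] fun x => δ ν x * sqrtDeriv ν.1 μ.1 x}
  add_mem' := by
    intro a b ha hb μ ν
    filter_upwards [ha μ ν, hb μ ν, Lp.coeFn_add (a μ) (b μ),
      (ac μ.2 ν.2).ae_le (Lp.coeFn_add (a ν) (b ν))] with x h1 h2 h3 h4
    simp only [Pi.add_apply] at h3 h4 ⊢
    rw [h3, h4, h1, h2]; ring
  zero_mem' := by
    intro μ ν
    filter_upwards [Lp.coeFn_zero ℝ 2 μ.1, (ac μ.2 ν.2).ae_le (Lp.coeFn_zero ℝ 2 ν.1)] with x h1 h2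
    simp only [Pi.zero_apply] at h1 h2 ⊢
    rw [h1, h2, zero_mul]
  smul_mem' := by
    intro c a ha μ ν
    filter_upwards [ha μ ν, Lp.coeFn_smul c (a μ),
      (ac μ.2 ν.2).ae_le (Lp.coeFn_smul c (a ν))] with x h1 h3 h4
    simp only [Pi.smul_apply, smul_eq_mul] at h3 h4 ⊢
    rw [h3, h4, h1]; ring

/-- The coordinate of a half-density with respect to a representative. -/
def coord {𝒞 : MeasureClass X} (δ : HalfDensity 𝒞) (μ : 𝒞.Rep) :
    Lp ℝ 2 (μ : Measure X) :=
  δ.1 μ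

theorem memLp_sqrtDeriv (ν μ : Measure X) [IsFiniteMeasure ν] : MemLp (sqrtDeriv ν μ) 2 μ := by
  rw [memLp_two_iff_integrable_sq (measurable_sqrtDeriv ν μ).aestronglyMeasurable]
  simp only [sqrtDeriv, Real.sq_sqrt ENNReal.toReal_nonneg]
  exact Measure.integrable_toReal_rnDeriv

/-- The positive square root `ν^{1/2}` in `ℋ(𝒞)` of a finite measure `ν` in `𝒞`. -/
def sqrtMeasure {𝒞 : MeasureClass X} (ν : Measure X) [IsFiniteMeasure ν] (hν : ν ∈ 𝒞) :
    HalfDensity 𝒞 :=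
  ⟨fun μ => (memLp_sqrtDeriv ν μ.1).toLp, fun μ ρ => by
    filter_upwards [(memLp_sqrtDeriv ν μ.1).coeFn_toLp,
      (ac μ.2 ρ.2).ae_le (memLp_sqrtDeriv ν ρ.1).coeFn_toLp,
      sqrtDeriv_mul ν ρ.1 μ.1 (ac hν ρ.2)] with x h1 h2 h3
    rw [h1, h2, h3]⟩

/-- Almost every section of an `L²` kernel is in `L²`. -/
theorem ae_memLp_section {μ : Measure X} [SigmaFinite μ] {K : X × X → ℝ}
    (hK : MemLp K 2 (μ.prod μ)) : ∀ᵐ x ∂μ, MemLp (fun y => K (x, y)) 2 μ := by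
  have h := (memLp_two_iff_integrable_sq hK.1).1 hK
  filter_upwards [h.prod_right_ae, hK.1.prodMk_left] with x hx hm
  exact (memLp_two_iff_integrable_sq hm).2 hx

/-- An `L²` kernel maps `L²` to `L²`. -/
theorem memLp_kernel {μ : Measure X} [SigmaFinite μ] {K : X × X → ℝ}
    (hK : MemLp K 2 (μ.prod μ)) {f : X → ℝ} (hf : MemLp f 2 μ) :
    MemLp (fun x => ∫ y, K (x, y) * f y ∂μ) 2 μ := by
  have hm : AEStronglyMeasurable (fun x => ∫ y, K (x, y) * f y ∂μ) μ :=
    AEStronglyMeasurable.integral_prod_right' (f := fun p : X × X => K p * f p.2)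
      (hK.1.mul hf.1.comp_snd)
  rw [memLp_two_iff_integrable_sq hm]
  have hK2 := (memLp_two_iff_integrable_sq hK.1).1 hK
  have hI : Integrable (fun x => (∫ y, K (x, y) ^ 2 ∂μ) * ∫ y, f y ^ 2 ∂μ) μ :=
    hK2.integral_prod_left.mul_const _
  refine hI.mono (hm.pow 2) ?_
  filter_upwards [ae_memLp_section hK] with x hx
  rw [Real.norm_of_nonneg (sq_nonneg _), Real.norm_of_nonneg (by positivity)]
  have hxs := (memLp_two_iff_integrable_sq hx.1).1 hx
  have hfs := (memLp_two_iff_integrable_sq hf.1).1 hf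
  have hxf : Integrable (fun y => K (x, y) * f y) μ := hx.integrable_mul hf
  have key : ∀ t : ℝ, 0 ≤ (∫ y, f y ^ 2 ∂μ) * (t * t) + (2 * ∫ y, K (x, y) * f y ∂μ) * t
      + ∫ y, K (x, y) ^ 2 ∂μ := by
    intro t
    have h1 : 0 ≤ ∫ y, (K (x, y) + t * f y) ^ 2 ∂μ := integral_nonneg fun y => sq_nonneg _
    have h2 : ∫ y, (K (x, y) + t * f y) ^ 2 ∂μ =
        ∫ y, (K (x, y) ^ 2 + ((2 * t) * (K (x, y) * f y) + t ^ 2 * f y ^ 2)) ∂μ := by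
      congr 1; ext y; ring
    have h3 : Integrable (fun y => (2 * t) * (K (x, y) * f y)) μ := hxf.const_mul _
    have h4 : Integrable (fun y => t ^ 2 * f y ^ 2) μ := hfs.const_mul _
    have h5 : Integrable (fun y => (2 * t) * (K (x, y) * f y) + t ^ 2 * f y ^ 2) μ := h3.add h4
    rw [h2, integral_add hxs h5, integral_add h3 h4, integral_const_mul,
      integral_const_mul] at h1
    linarith
  have := discrim_le_zero key
  rw [discrim] at this
  nlinarith

/-- The coordinates of `K δ`, see `kernelOp`. -/
def kernelCoord {𝒞 : MeasureClass X} (K : HalfDensity (𝒞.tensor 𝒞)) (δ : HalfDensity 𝒞)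
    (μ : 𝒞.Rep) : Lp ℝ 2 (μ : Measure X) :=
  MemLp.toLp (fun x => ∫ y, coord K (μ.prod μ) (x, y) * coord δ μ y ∂μ.1)
    (memLp_kernel (Lp.memLp (coord K (μ.prod μ))) (Lp.memLp (coord δ μ)))

theorem coeFn_kernelCoord {𝒞 : MeasureClass X} (K : HalfDensity (𝒞.tensor 𝒞))
    (δ : HalfDensity 𝒞) (μ : 𝒞.Rep) :
    kernelCoord K δ μ =ᵐ[μ.1] fun x => ∫ y, coord K (μ.prod μ) (x, y) * coord δ μ y ∂μ.1 :=
  MemLp.coeFn_toLp _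

theorem kernelCoord_mem {𝒞 : MeasureClass X} (K : HalfDensity (𝒞.tensor 𝒞))
    (δ : HalfDensity 𝒞) : kernelCoord K δ ∈ HalfDensity 𝒞 := by
  intro μ ν
  have hμν := ac μ.2 ν.2
  have hνμ := ac ν.2 μ.2
  filter_upwards [coeFn_kernelCoord K δ μ, hμν.ae_le (coeFn_kernelCoord K δ ν),
    Measure.ae_ae_of_ae_prod (K.2 (μ.prod μ) (ν.prod ν)),
    Measure.ae_ae_of_ae_prod (sqrtDeriv_prod ν.1 μ.1 hνμ)] with x h1 h2 h3 h4
  rw [h1, h2, ← integral_rnDeriv_smul hνμ, ← integral_mul_const]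
  apply integral_congr_ae
  filter_upwards [h3, h4, δ.2 μ ν] with y h3 h4 h5
  change coord K (μ.prod μ) (x, y) = coord K (ν.prod ν) (x, y) *
    sqrtDeriv (ν.1.prod ν.1) (μ.1.prod μ.1) (x, y) at h3
  change coord δ μ y = coord δ ν y * _ at h5
  have h6 : sqrtDeriv ν.1 μ.1 y * sqrtDeriv ν.1 μ.1 y = (ν.1.rnDeriv μ.1 y).toReal :=
    Real.mul_self_sqrt ENNReal.toReal_nonneg
  rw [h3, h4, h5, smul_eq_mul, ← h6]
  ring

/-- The operator on `ℋ(𝒞)` given by a half-density `K` on `X × X` of class `𝒞 ⊗ 𝒞`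
(an element of `ℋ(𝒞) ⊗ ℋ(𝒞)`, i.e. the kernel of a Hilbert–Schmidt operator): in the coordinates of
each representative `μ` it is `(K δ)_μ (x) = ∫ K_{μ × μ} (x, y) δ_μ (y) dμ(y)`. -/
def kernelOp {𝒞 : MeasureClass X} (K : HalfDensity (𝒞.tensor 𝒞)) :
    HalfDensity 𝒞 →ₗ[ℝ] HalfDensity 𝒞 where
  toFun δ := ⟨kernelCoord K δ, kernelCoord_mem K δ⟩
  map_add' a b := by
    refine Subtype.ext (funext fun μ => Lp.ext ?_)
    change kernelCoord K (a + b) μ =ᵐ[μ.1] (kernelCoord K a μ + kernelCoord K b μ : Lp ℝ 2 μ.1)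
    filter_upwards [coeFn_kernelCoord K (a + b) μ, coeFn_kernelCoord K a μ,
      coeFn_kernelCoord K b μ, Lp.coeFn_add (kernelCoord K a μ) (kernelCoord K b μ),
      ae_memLp_section (μ := μ.1) (Lp.memLp (coord K (μ.prod μ)))] with x h0 h1 h2 h3 h4
    have ia : Integrable (fun y => coord K (μ.prod μ) (x, y) * coord a μ y) μ.1 :=
      h4.integrable_mul (Lp.memLp (coord a μ))
    have ib : Integrable (fun y => coord K (μ.prod μ) (x, y) * coord b μ y) μ.1 :=
      h4.integrable_mul (Lp.memLp (coord b μ))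
    rw [h0, h3, Pi.add_apply, h1, h2, ← integral_add ia ib]
    apply integral_congr_ae
    filter_upwards [Lp.coeFn_add (coord a μ) (coord b μ)] with y hy
    change _ * (coord a μ + coord b μ : Lp ℝ 2 μ.1) y = _
    rw [hy, Pi.add_apply, mul_add]
  map_smul' c a := by
    refine Subtype.ext (funext fun μ => Lp.ext ?_)
    change kernelCoord K (c • a) μ =ᵐ[μ.1] (c • kernelCoord K a μ : Lp ℝ 2 μ.1)
    filter_upwards [coeFn_kernelCoord K (c • a) μ, coeFn_kernelCoord K a μ,
      Lp.coeFn_smul c (kernelCoord K a μ)] with x h0 h1 h3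
    rw [h0, h3, Pi.smul_apply, h1, smul_eq_mul, ← integral_const_mul]
    apply integral_congr_ae
    filter_upwards [Lp.coeFn_smul c (coord a μ)] with y hy
    change _ * (c • coord a μ : Lp ℝ 2 μ.1) y = _
    rw [hy, Pi.smul_apply, smul_eq_mul]
    ring

/-- `ν₃` is the half-density composition of the finite measures `ν₁`, `ν₂` in `𝒞 ⊗ 𝒞`: it is a finite
measure in `𝒞 ⊗ 𝒞` such that `ν₁^{1/2} ∘ ν₂^{1/2} = ν₃^{1/2}` as operators on `ℋ(𝒞)`, and
`ν₃(φ, ψ) = (∫_η ν₁(φ, η)^{1/2} ν₂(η, ψ)^{1/2})²`, which is read in the coordinates of each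
representative `μ` of `𝒞`. -/
def IsComposition (𝒞 : MeasureClass X) (ν₁ ν₂ : Measure (X × X)) [IsFiniteMeasure ν₁]
    [IsFiniteMeasure ν₂] (h₁ : ν₁ ∈ 𝒞.tensor 𝒞) (h₂ : ν₂ ∈ 𝒞.tensor 𝒞)
    (ν₃ : Measure (X × X)) : Prop :=
  ∃ (_ : IsFiniteMeasure ν₃) (h₃ : ν₃ ∈ 𝒞.tensor 𝒞),
    kernelOp (sqrtMeasure ν₁ h₁) ∘ₗ kernelOp (sqrtMeasure ν₂ h₂) = kernelOp (sqrtMeasure ν₃ h₃) ∧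
    ∀ μ : 𝒞.Rep, ∀ᵐ p ∂(μ.1.prod μ.1),
      (ν₃.rnDeriv (μ.1.prod μ.1) p).toReal =
        (∫ η, coord (sqrtMeasure ν₁ h₁) (μ.prod μ) (p.1, η) *
          coord (sqrtMeasure ν₂ h₂) (μ.prod μ) (η, p.2) ∂μ.1) ^ 2

end HalfDensities

end

/-!
Bernstein's theorem characterizes the Gaussian measures: a probability measure `ν` is Gaussian if
and only if the rotation `(x, y) ↦ (x + y, x - y)` carries `ν × ν` to a product measure. Relative to
a Gaussian reference measure this means that the density `f` of `ν` satisfies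
`f x * f y = p (x + y) * q (x - y)` almost everywhere for some `p` and `q`. Such a factorization
survives square roots and squares, and, by rotating the two integration variables, compositions of
kernels; so the half-density composition of Gaussian measures is Gaussian up to normalization.
On the real line, Bernstein's theorem amounts to the functional equation
`φ (s + t) * φ (s - t) = a s * b t` for a characteristic function `φ`, which makes `log φ` a
quadratic polynomial. The composition is a finite measure by the Cauchy–Schwarz inequality, and its
independence of the reference measure is the chain rule for Radon–Nikodym derivatives.
-/

noncomputable section

namespace HalfDensities

open MeasureClass

section RealLine

theorem exists_eq_smul_of_map_add {V : Type*} [AddCommGroup V] [Module ℝ V] [TopologicalSpace V]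
    [ContinuousSMul ℝ V] [T2Space V] {f : ℝ → V} (hf : Continuous f)
    (hadd : ∀ s t, f (s + t) = f s + f t) : ∃ v, ∀ t, f t = t • v :=
  ⟨f 1, fun t => by simpa using map_real_smul (AddMonoidHom.mk' f hadd) hf t 1⟩

theorem exists_eq_sq_smul_add_smul_of_cube {V : Type*} [AddCommGroup V] [Module ℝ V]
    [TopologicalSpace V] [IsTopologicalAddGroup V] [ContinuousSMul ℝ V] [T2Space V] {f : ℝ → V}
    (hf : Continuous f)
    (hcube : ∀ a b c, f (a + b + c) + f a + f b + f c = f (a + b) + f (a + c) + f (b + c)) :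
    ∃ q l, ∀ t, f t = t ^ 2 • q + t • l := by
  have polar_smul_left (t : ℝ) : ∃ v, ∀ s, f (s + t) - f s - f t = s • v :=
    exists_eq_smul_of_map_add (by fun_prop) fun a b => by
      linear_combination (norm := module) hcube a b t
  choose B hB using polar_smul_left
  have hB_one (t : ℝ) : B t = f (1 + t) - f 1 - f t := by rw [hB, one_smul]
  obtain ⟨v, hv⟩ : ∃ v, ∀ t, B t = t • v := by
    refine exists_eq_smul_of_map_add (by simp_rw [funext hB_one]; fun_prop) fun a b => ?_
    rw [hB_one, hB_one, hB_one, ← add_assoc]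
    linear_combination (norm := module) hcube 1 a b
  obtain ⟨l, hl⟩ : ∃ l, ∀ t, f t - t ^ 2 • (2⁻¹ : ℝ) • v = t • l := by
    refine exists_eq_smul_of_map_add (by fun_prop) fun a b => ?_
    have hab : f (a + b) = f a + f b + a • b • v := by rw [← hv, ← hB]; abel
    rw [hab]
    module
  exact ⟨_, l, fun t => sub_eq_iff_eq_add'.1 (hl t)⟩

theorem eq_of_exp_comp_eq {A : Type*} [TopologicalSpace A] [PreconnectedSpace A] {f g : A → ℂ}
    (hf : Continuous f) (hg : Continuous g) (h : ∀ a, Complex.exp (f a) = Complex.exp (g a))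
    {a₀ : A} (h₀ : f a₀ = g a₀) : f = g :=
  Complex.isCoveringMap_exp.eq_of_comp_eq hf hg (funext fun a => Subtype.ext (h a)) a₀ h₀

theorem exists_continuous_exp_eq {A : Type*} [TopologicalSpace A] [SimplyConnectedSpace A]
    [LocallyPathConnectedSpace A] {φ : A → ℂ} (hφ : Continuous φ) (hne : ∀ a, φ a ≠ 0) {a₀ : A}
    {z₀ : ℂ} (h₀ : Complex.exp z₀ = φ a₀) :
    ∃ f : A → ℂ, Continuous f ∧ f a₀ = z₀ ∧ ∀ a, φ a = Complex.exp (f a) := by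
  obtain ⟨f, ⟨hf₀, hf⟩, -⟩ :=
    Complex.isCoveringMapOn_exp.existsUnique_continuousMap_lifts ⟨φ, hφ⟩ h₀ hne
  exact ⟨f, f.continuous, hf₀, fun a => (congr_fun hf a).symm⟩

theorem ne_zero_of_forall_double {V M : Type*} [AddCommGroup V] [Module ℝ V] [TopologicalSpace V]
    [ContinuousSMul ℝ V] [TopologicalSpace M] [Zero M] [T1Space M]
    {φ : V → M} (hφ : Continuous φ) (h₀ : φ 0 ≠ 0)
    (hdouble : ∀ x, φ x ≠ 0 → φ (2 • x) ≠ 0) (x : V) : φ x ≠ 0 := by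
  have hpow (n : ℕ) (y : V) (hy : φ y ≠ 0) : φ ((2 ^ n : ℝ) • y) ≠ 0 := by
    induction n with
    | zero => simpa using hy
    | succ n ih =>
      convert hdouble _ ih using 2
      module
  have hlim : Filter.Tendsto (fun n : ℕ => φ ((2⁻¹ : ℝ) ^ n • x)) Filter.atTop (nhds (φ 0)) := by
    have h := (tendsto_pow_atTop_nhds_zero_of_lt_one (r := (2⁻¹ : ℝ)) (by norm_num)
      (by norm_num)).smul_const x
    rw [zero_smul] at h
    exact (hφ.tendsto 0).comp h
  obtain ⟨n, hn⟩ := (hlim.eventually_ne h₀).exists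
  simpa [smul_smul, ← mul_pow] using hpow n _ hn

theorem ne_zero_of_factorization {V M : Type*} [AddCommGroup V] [Module ℝ V] [TopologicalSpace V]
    [IsTopologicalAddGroup V] [ContinuousSMul ℝ V] [TopologicalSpace M] [MulZeroClass M]
    [NoZeroDivisors M] [ContinuousMul M] [T1Space M] {φ u v : V → M} (hφ : Continuous φ)
    (h₀ : φ 0 ≠ 0) (h : ∀ s t, φ (s + t) * φ (s - t) = u s * v t) (x : V) : φ x ≠ 0 := by
  refine left_ne_zero_of_mul (b := φ (-x)) (ne_zero_of_forall_double
    (φ := fun s => φ s * φ (-s)) (by fun_prop) (by simpa using h₀) (fun s hs => ?_) x)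
  have hu (t : V) (ht : φ t ≠ 0) : u t ≠ 0 := by
    have := h t 0
    rw [add_zero, sub_zero] at this
    exact left_ne_zero_of_mul (this ▸ mul_ne_zero ht ht)
  have hv (t : V) (ht : φ t * φ (-t) ≠ 0) : v t ≠ 0 := by
    have := h 0 t
    rw [zero_add, zero_sub] at this
    exact right_ne_zero_of_mul (this ▸ ht)
  have hdouble (t : V) (ht : φ t * φ (-t) ≠ 0) : φ (2 • t) ≠ 0 := by
    have := h t t
    rw [← two_smul ℕ] at this
    exact left_ne_zero_of_mul (this ▸ mul_ne_zero (hu t (left_ne_zero_of_mul ht)) (hv t ht))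
  rw [← smul_neg]
  refine mul_ne_zero (hdouble s hs) (hdouble (-s) ?_)
  rw [neg_neg]
  exact mul_ne_zero (right_ne_zero_of_mul hs) (left_ne_zero_of_mul hs)

theorem mul_cube_of_factorization {V M : Type*} [AddCommGroup V] [Module ℝ V] [CommSemigroup M]
    {φ u v : V → M} (h : ∀ s t, φ (s + t) * φ (s - t) = u s * v t) (a b c : V) :
    φ (a + b + c) * φ a * (φ b * φ c) = φ (a + b) * φ (a + c) * (φ (b + c) * φ 0) := by
  set m := (2⁻¹ : ℝ) • (b + c)
  set d := (2⁻¹ : ℝ) • (b - c)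
  have h₁ : φ (a + b + c) * φ a = u (a + m) * v m := by rw [← h]; congr 2 <;> module
  have h₂ : φ b * φ c = u m * v d := by rw [← h]; congr 2 <;> module
  have h₃ : φ (a + b) * φ (a + c) = u (a + m) * v d := by rw [← h]; congr 2 <;> module
  have h₄ : φ (b + c) * φ 0 = u m * v m := by rw [← h]; congr 2 <;> module
  rw [h₁, h₂, h₃, h₄]
  ac_rfl

theorem exists_eq_exp_quadratic {φ u v : ℝ → ℂ} (hφ : Continuous φ) (hφ₀ : φ 0 = 1)
    (h : ∀ s t, φ (s + t) * φ (s - t) = u s * v t) :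
    ∃ q l : ℂ, ∀ t : ℝ, φ t = Complex.exp (t ^ 2 • q + t • l) := by
  have hne : ∀ t, φ t ≠ 0 := ne_zero_of_factorization hφ (by simp [hφ₀]) h
  obtain ⟨f, hf, hf₀, hφf⟩ := exists_continuous_exp_eq hφ hne (z₀ := 0) (a₀ := 0) (by simp [hφ₀])
  have hlog : (fun x : ℝ × ℝ × ℝ => f (x.1 + x.2.1 + x.2.2) + f x.1 + f x.2.1 + f x.2.2) =
      fun x => f (x.1 + x.2.1) + f (x.1 + x.2.2) + f (x.2.1 + x.2.2) := by
    refine eq_of_exp_comp_eq (by fun_prop) (by fun_prop) (fun x => ?_) (a₀ := 0) (by simp [hf₀])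
    simp only [Complex.exp_add, ← hφf]
    have := mul_cube_of_factorization h x.1 x.2.1 x.2.2
    rwa [hφ₀, mul_one, ← mul_assoc] at this
  obtain ⟨q, l, hql⟩ :=
    exists_eq_sq_smul_add_smul_of_cube hf fun a b c => congr_fun hlog (a, b, c)
  exact ⟨q, l, fun t => by rw [hφf, hql]⟩

theorem exists_eq_gaussianReal_of_charFun_eq_exp {p : Measure ℝ} [IsProbabilityMeasure p] {q l : ℂ}
    (h : ∀ t : ℝ, charFun p t = Complex.exp (t ^ 2 • q + t • l)) :
    ∃ m v, p = gaussianReal m v := by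
  have hconj : (fun t : ℝ => (-t) ^ 2 • q + (-t) • l) =
      fun t : ℝ => t ^ 2 • star q + t • star l := by
    refine eq_of_exp_comp_eq (by fun_prop) (by fun_prop) (fun t => ?_) (a₀ := 0) (by simp)
    rw [← h, charFun_neg, h, ← Complex.exp_conj]
    simp
  have h₁ : q - l = star q + star l := by simpa [sub_eq_add_neg] using congr_fun hconj 1
  have h₂ : q + l = star q - star l := by simpa [sub_eq_add_neg] using congr_fun hconj (-1)
  obtain ⟨a, rfl⟩ : ∃ a : ℝ, q = a := Complex.conj_eq_iff_real.1 <|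
    show star q = q by linear_combination (-1 / 2 : ℂ) * (h₁ + h₂)
  have hl_re : l.re = 0 := by
    have := congr_arg Complex.re h₂
    simp only [Complex.add_re, Complex.sub_re, Complex.star_def, Complex.conj_re] at this
    linarith
  have hl : l = l.im * Complex.I := Complex.ext (by simpa using hl_re) (by simp)
  have ha : a ≤ 0 := by
    have := norm_charFun_le_one (μ := p) 1
    rw [h, Complex.norm_exp] at this
    simpa [hl_re] using this
  refine ⟨l.im, (-2 * a).toNNReal, Measure.ext_of_charFun (funext fun t => ?_)⟩
  rw [h, charFun_gaussianReal, Real.coe_toNNReal _ (by linarith)]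
  congr 1
  rw [hl]
  simp only [Complex.real_smul, Complex.mul_I_im, Complex.ofReal_re]
  push_cast
  ring

end RealLine

section Cylinder

/-- The `σ`-algebra of `E` is the one generated by the continuous linear functionals. -/
class CylinderMeasurableSpace (E : Type*) [AddCommGroup E] [Module ℝ E] [TopologicalSpace E]
    [mE : MeasurableSpace E] : Prop where
  eq_cylinderSigmaAlgebra : mE = cylinderSigmaAlgebra E

variable {E F : Type*} [AddCommGroup E] [Module ℝ E] [TopologicalSpace E]
  [AddCommGroup F] [Module ℝ F] [TopologicalSpace F]

theorem coprod_dual_comp_inl_inr (L : StrongDual ℝ (E × F)) :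
    (L.comp (.inl ℝ E F)).coprod (L.comp (.inr ℝ E F)) = L :=
  ContinuousLinearMap.ext fun p => by simp [← map_add]

variable [mE : MeasurableSpace E] [CylinderMeasurableSpace E] [MeasurableSpace F]
  [CylinderMeasurableSpace F]

variable (E) in
theorem measurableSpace_eq_iSup_comap_dual :
    mE = ⨆ L : StrongDual ℝ E, MeasurableSpace.comap L inferInstance := by
  simp_rw [BorelSpace.measurable_eq (α := ℝ)]
  exact CylinderMeasurableSpace.eq_cylinderSigmaAlgebra

theorem measurable_dual (L : StrongDual ℝ E) : Measurable L := by
  rw [measurable_iff_comap_le]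
  conv_rhs => rw [measurableSpace_eq_iSup_comap_dual E]
  exact le_iSup (fun L : StrongDual ℝ E => MeasurableSpace.comap L inferInstance) L

theorem comap_le_iff_dual {α : Type*} {m : MeasurableSpace α} {f : α → E} :
    mE.comap f ≤ m ↔ ∀ L : StrongDual ℝ E, Measurable fun a => L (f a) := by
  rw [measurableSpace_eq_iSup_comap_dual E, MeasurableSpace.comap_iSup, iSup_le_iff]
  simp_rw [MeasurableSpace.comap_comp, ← measurable_iff_comap_le, Function.comp_def]

theorem measurable_iff_dual {α : Type*} [MeasurableSpace α] {f : α → E} :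
    Measurable f ↔ ∀ L : StrongDual ℝ E, Measurable fun a => L (f a) :=
  measurable_iff_comap_le.trans comap_le_iff_dual

instance : MeasurableAdd₂ E :=
  ⟨measurable_iff_dual.2 fun L => by
    simp only [map_add]
    exact ((measurable_dual L).comp measurable_fst).add ((measurable_dual L).comp measurable_snd)⟩

instance : MeasurableSub₂ E :=
  ⟨measurable_iff_dual.2 fun L => by
    simp only [map_sub]
    exact ((measurable_dual L).comp measurable_fst).sub ((measurable_dual L).comp measurable_snd)⟩

instance : MeasurableConstSMul ℝ E :=
  ⟨fun c => measurable_iff_dual.2 fun L => by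
    simp only [map_smul]
    exact (measurable_dual L).const_smul c⟩

instance : CylinderMeasurableSpace (E × F) where
  eq_cylinderSigmaAlgebra := by
    simp_rw [cylinderSigmaAlgebra, ← BorelSpace.measurable_eq (α := ℝ)]
    apply le_antisymm
    · refine sup_le (comap_le_iff_dual.2 fun L => ?_) (comap_le_iff_dual.2 fun L => ?_)
      · rw [measurable_iff_comap_le]
        exact le_iSup (fun L : StrongDual ℝ (E × F) => MeasurableSpace.comap L inferInstance)
          (L.comp (.fst ℝ E F))
      · rw [measurable_iff_comap_le]
        exact le_iSup (fun L : StrongDual ℝ (E × F) => MeasurableSpace.comap L inferInstance)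
          (L.comp (.snd ℝ E F))
    · refine iSup_le fun L => Measurable.comap_le ?_
      rw [← coprod_dual_comp_inl_inr L]
      exact ((measurable_dual (L.comp (.inl ℝ E F))).comp measurable_fst).add
        ((measurable_dual (L.comp (.inr ℝ E F))).comp measurable_snd)

end Cylinder

section CharFunctional

/-- The characteristic functional `L ↦ ∫ exp(i L x) dμ(x)` of a measure on a topological vector
space, the counterpart of `charFunDual` without a norm. -/
def charFunctional {E : Type*} [AddCommGroup E] [Module ℝ E] [TopologicalSpace E]
    [MeasurableSpace E] (μ : Measure E) (L : StrongDual ℝ E) : ℂ :=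
  ∫ x, Complex.exp (L x * Complex.I) ∂μ

variable {E F : Type*} [AddCommGroup E] [Module ℝ E] [TopologicalSpace E]
  [mE : MeasurableSpace E] [AddCommGroup F] [Module ℝ F] [TopologicalSpace F] [MeasurableSpace F]

theorem charFunctional_prod (μ : Measure E) (ν : Measure F) [SFinite μ] [SFinite ν]
    (L₁ : StrongDual ℝ E) (L₂ : StrongDual ℝ F) :
    charFunctional (μ.prod ν) (L₁.coprod L₂) = charFunctional μ L₁ * charFunctional ν L₂ := by
  simp only [charFunctional, ← integral_prod_mul, ← Complex.exp_add, ← add_mul,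
    ← Complex.ofReal_add, ContinuousLinearMap.coprod_apply]

theorem charFunctional_map [CylinderMeasurableSpace F] {f : E → F} (hf : Measurable f)
    (μ : Measure E) (L : StrongDual ℝ F) (L' : StrongDual ℝ E) (hL : ∀ x, L (f x) = L' x) :
    charFunctional (μ.map f) L = charFunctional μ L' := by
  have hm := measurable_dual L
  simp only [charFunctional, integral_map hf.aemeasurable
    (f := fun x => Complex.exp (L x * Complex.I)) (by fun_prop), hL]

variable [CylinderMeasurableSpace E]

theorem charFun_map_dual (μ : Measure E) (L : StrongDual ℝ E) (t : ℝ) :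
    charFun (μ.map L) t = charFunctional μ (t • L) := by
  rw [charFun_apply_real, integral_map (measurable_dual L).aemeasurable (by fun_prop)]
  simp [charFunctional]

theorem map_restrict_dual_eq_of_charFunctional_eq {μ ν : Measure E} [IsFiniteMeasure μ]
    [IsFiniteMeasure ν] (h : charFunctional μ = charFunctional ν) (I : Finset (StrongDual ℝ E)) :
    (μ.map fun x (L : I) => L.1 x) = ν.map fun x (L : I) => L.1 x := by
  classical
  have hm : Measurable fun x (L : I) => L.1 x :=
    measurable_pi_lambda _ fun L => measurable_dual L.1
  refine Measure.ext_of_charFunDual (funext fun Λ => ?_)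
  have hΛ (x : E) : Λ (fun L : I => L.1 x) =
      (∑ L : I, Λ (fun j => if L = j then 1 else 0) • L.1) x := by
    refine (LinearMap.pi_apply_eq_sum_univ (Λ : (I → ℝ) →ₗ[ℝ] ℝ) _).trans ?_
    simp [mul_comm]
  rw [charFunDual_apply, charFunDual_apply, integral_map hm.aemeasurable (by fun_prop),
    integral_map hm.aemeasurable (by fun_prop)]
  simp_rw [hΛ]
  exact congr_fun h _

theorem ext_of_charFunctional {μ ν : Measure E} [IsFiniteMeasure μ] [IsFiniteMeasure ν]
    (h : charFunctional μ = charFunctional ν) : μ = ν := by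
  let ev : E → StrongDual ℝ E → ℝ := fun x L => L x
  have hev : Measurable ev := measurable_pi_lambda _ measurable_dual
  have hμν : μ.map ev = ν.map ev := by
    refine IsProjectiveLimit.unique (P := fun I => (ν.map ev).map I.restrict) (fun I => ?_)
      fun _ => rfl
    change (μ.map ev).map I.restrict = (ν.map ev).map I.restrict
    rw [Measure.map_map (by fun_prop) hev, Measure.map_map (by fun_prop) hev]
    exact map_restrict_dual_eq_of_charFunctional_eq h I
  have hcomap : mE = MeasurableSpace.comap ev inferInstance := by
    rw [MeasurableSpace.pi, MeasurableSpace.comap_iSup]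
    conv_lhs => rw [measurableSpace_eq_iSup_comap_dual E]
    exact iSup_congr fun L => by rw [MeasurableSpace.comap_comp]; rfl
  ext s hs
  rw [hcomap] at hs
  obtain ⟨t, ht, rfl⟩ := hs
  rw [← Measure.map_apply hev ht, ← Measure.map_apply hev ht, hμν]

theorem ext_prod_of_charFunctional [CylinderMeasurableSpace F] {μ ν : Measure (E × F)}
    [IsFiniteMeasure μ] [IsFiniteMeasure ν]
    (h : ∀ (L₁ : StrongDual ℝ E) (L₂ : StrongDual ℝ F),
      charFunctional μ (L₁.coprod L₂) = charFunctional ν (L₁.coprod L₂)) : μ = ν :=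
  ext_of_charFunctional <| funext fun L => by rw [← coprod_dual_comp_inl_inr L, h]

end CharFunctional

section Rotation

/-- The unnormalized rotation `(x, y) ↦ (x + y, x - y)` of `E × E`. -/
def addSub (E : Type*) [AddCommGroup E] [Module ℝ E] [MeasurableSpace E] [MeasurableAdd₂ E]
    [MeasurableSub₂ E] [MeasurableConstSMul ℝ E] : E × E ≃ᵐ E × E where
  toFun p := (p.1 + p.2, p.1 - p.2)
  invFun p := ((2⁻¹ : ℝ) • (p.1 + p.2), (2⁻¹ : ℝ) • (p.1 - p.2))
  left_inv p := by ext <;> module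
  right_inv p := by ext <;> module
  measurable_toFun := by
    change Measurable fun p : E × E => (p.1 + p.2, p.1 - p.2)
    fun_prop
  measurable_invFun := by
    change Measurable fun p : E × E => ((2⁻¹ : ℝ) • (p.1 + p.2), (2⁻¹ : ℝ) • (p.1 - p.2))
    fun_prop

@[simp]
theorem addSub_apply {E : Type*} [AddCommGroup E] [Module ℝ E] [MeasurableSpace E]
    [MeasurableAdd₂ E] [MeasurableSub₂ E] [MeasurableConstSMul ℝ E] (p : E × E) :
    addSub E p = (p.1 + p.2, p.1 - p.2) :=
  rfl

variable {E : Type*} [AddCommGroup E] [Module ℝ E] [TopologicalSpace E] [MeasurableSpace E]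
  [CylinderMeasurableSpace E]

theorem charFunctional_map_addSub (μ ν : Measure E) [SFinite μ] [SFinite ν]
    (L₁ L₂ : StrongDual ℝ E) :
    charFunctional ((μ.prod ν).map (addSub E)) (L₁.coprod L₂) =
      charFunctional μ (L₁ + L₂) * charFunctional ν (L₁ - L₂) := by
  rw [← charFunctional_prod]
  refine charFunctional_map (addSub E).measurable _ _ _ fun p => ?_
  simp only [ContinuousLinearMap.coprod_apply, addSub_apply, map_add, map_sub, add_apply, sub_apply]
  ring

end Rotation

section Gaussian

variable {E : Type*} [AddCommGroup E] [Module ℝ E] [TopologicalSpace E] [MeasurableSpace E]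
  [CylinderMeasurableSpace E]

theorem memLp_two_dual_of_isGaussian (μ : Measure E) [IsGaussian μ] (L : StrongDual ℝ E) :
    MemLp L 2 μ := by
  suffices MemLp (id ∘ L) 2 μ from this
  rw [← memLp_map_measure_iff (by fun_prop) (measurable_dual L).aemeasurable,
    IsGaussian.map_eq_gaussianReal L]
  exact memLp_id_gaussianReal 2

theorem charFunctional_of_isGaussian (μ : Measure E) [IsGaussian μ] (L : StrongDual ℝ E) :
    charFunctional μ L = Complex.exp ((μ[L] : ℝ) * Complex.I - Var[L; μ] / 2) := by
  have h := charFun_map_dual μ L 1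
  rw [IsGaussian.map_eq_gaussianReal, charFun_gaussianReal,
    Real.coe_toNNReal _ (variance_nonneg _ _), one_smul] at h
  simpa using h.symm

theorem charFunctional_add_mul_charFunctional_sub_of_isGaussian (μ : Measure E) [IsGaussian μ]
    (L₁ L₂ : StrongDual ℝ E) :
    charFunctional μ (L₁ + L₂) * charFunctional μ (L₁ - L₂) =
      charFunctional μ L₁ ^ 2 * (charFunctional μ L₂ * charFunctional μ (-L₂)) := by
  have hL₁ := memLp_two_dual_of_isGaussian μ L₁
  have hL₂ := memLp_two_dual_of_isGaussian μ L₂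
  have mean_add : μ[(L₁ + L₂ : StrongDual ℝ E)] = μ[L₁] + μ[L₂] :=
    integral_add (hL₁.integrable one_le_two) (hL₂.integrable one_le_two)
  have mean_sub : μ[(L₁ - L₂ : StrongDual ℝ E)] = μ[L₁] - μ[L₂] :=
    integral_sub (hL₁.integrable one_le_two) (hL₂.integrable one_le_two)
  have mean_neg : μ[(-L₂ : StrongDual ℝ E)] = -μ[L₂] := integral_neg _
  have var_add : Var[(L₁ + L₂ : StrongDual ℝ E); μ] =
      Var[L₁; μ] + 2 * cov[L₁, L₂; μ] + Var[L₂; μ] := variance_add hL₁ hL₂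
  have var_sub : Var[(L₁ - L₂ : StrongDual ℝ E); μ] =
      Var[L₁; μ] - 2 * cov[L₁, L₂; μ] + Var[L₂; μ] := variance_sub hL₁ hL₂
  have var_neg : Var[(-L₂ : StrongDual ℝ E); μ] = Var[L₂; μ] := variance_neg
  simp only [charFunctional_of_isGaussian, mean_add, mean_sub, mean_neg, var_add, var_sub, var_neg,
    sq, ← Complex.exp_add]
  congr 1
  push_cast
  ring

theorem exists_measurePreserving_addSub_of_isGaussian (μ : Measure E) [IsGaussian μ] :
    ∃ α β : Measure E, IsProbabilityMeasure α ∧ IsProbabilityMeasure β ∧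
      MeasurePreserving (addSub E) (μ.prod μ) (α.prod β) := by
  set ρ := (μ.prod μ).map (addSub E) with hρ
  have : IsProbabilityMeasure ρ :=
    Measure.isProbabilityMeasure_map (addSub E).measurable.aemeasurable
  refine ⟨ρ.fst, ρ.snd, inferInstance, inferInstance, (addSub E).measurable,
    ext_prod_of_charFunctional fun L₁ L₂ => ?_⟩
  have fst_eq : charFunctional ρ.fst L₁ = charFunctional μ L₁ ^ 2 := by
    rw [Measure.fst, charFunctional_map measurable_fst ρ L₁ (L₁.coprod 0) fun p => by simp, hρ,
      charFunctional_map_addSub, add_zero, sub_zero, sq]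
  have snd_eq : charFunctional ρ.snd L₂ = charFunctional μ L₂ * charFunctional μ (-L₂) := by
    rw [Measure.snd, charFunctional_map measurable_snd ρ L₂ (.coprod 0 L₂) fun p => by simp, hρ,
      charFunctional_map_addSub, zero_add, zero_sub]
  rw [charFunctional_prod, fst_eq, snd_eq, charFunctional_map_addSub,
    charFunctional_add_mul_charFunctional_sub_of_isGaussian]

theorem isGaussian_of_forall_exists_gaussianReal {μ : Measure E}
    (h : ∀ L : StrongDual ℝ E, ∃ m v, μ.map L = gaussianReal m v) : IsGaussian μ := by
  refine ⟨fun L => ?_⟩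
  have hL := (measurable_dual L).aemeasurable (μ := μ)
  obtain ⟨m, v, hmv⟩ := h L
  have mean_eq : μ[L] = m := by
    have := integral_map hL (f := id) (by fun_prop)
    rw [hmv] at this
    simpa using this.symm
  have var_eq : Var[L; μ] = v := by
    have := variance_map (X := id) (by fun_prop) hL
    rw [hmv] at this
    simpa using this.symm
  rw [mean_eq, var_eq, hmv, Real.toNNReal_coe]

theorem isGaussian_of_measurePreserving_addSub {μ α β : Measure E} [IsProbabilityMeasure μ]
    [SFinite α] [SFinite β] (h : MeasurePreserving (addSub E) (μ.prod μ) (α.prod β)) :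
    IsGaussian μ := by
  refine isGaussian_of_forall_exists_gaussianReal fun L => ?_
  have : IsProbabilityMeasure (μ.map L) :=
    Measure.isProbabilityMeasure_map (measurable_dual L).aemeasurable
  have factorization (s t : ℝ) : charFun (μ.map L) (s + t) * charFun (μ.map L) (s - t) =
      charFunctional α (s • L) * charFunctional β (t • L) := by
    have hsub : (s - t) • L = s • L - t • L := sub_smul s t L
    rw [charFun_map_dual, charFun_map_dual, add_smul, hsub, ← charFunctional_map_addSub, h.map_eq,
      charFunctional_prod]
  obtain ⟨q, l, hql⟩ := exists_eq_exp_quadratic continuous_charFun (by simp) factorization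
  exact exists_eq_gaussianReal_of_charFun_eq_exp hql

end Gaussian

section Product

variable {A B C D : Type*} [MeasurableSpace A] [MeasurableSpace B] [MeasurableSpace C]
  [MeasurableSpace D]

theorem measurePreserving_prodProdProdComm (μ : Measure A) (ν : Measure B) (ρ : Measure C)
    (σ : Measure D) [SFinite μ] [SFinite ν] [SFinite ρ] [SFinite σ] :
    MeasurePreserving (Equiv.prodProdProdComm A B C D) ((μ.prod ν).prod (ρ.prod σ))
      ((μ.prod ρ).prod (ν.prod σ)) := by
  have swap_middle : MeasurePreserving (fun w : B × C × D => (w.2.1, (w.1, w.2.2)))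
      (ν.prod (ρ.prod σ)) (ρ.prod (ν.prod σ)) :=
    (measurePreserving_prodAssoc ρ ν σ).comp <|
      (Measure.measurePreserving_swap.prod (.id σ)).comp
        ((measurePreserving_prodAssoc ν ρ σ).symm MeasurableEquiv.prodAssoc)
  exact ((measurePreserving_prodAssoc μ ρ (ν.prod σ)).symm MeasurableEquiv.prodAssoc).comp <|
    ((MeasurePreserving.id μ).prod swap_middle).comp (measurePreserving_prodAssoc μ ν (ρ.prod σ))

theorem map_withDensity_comp (μ : Measure A) {T : A → B} (hT : Measurable T) {f : B → ℝ≥0∞}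
    (hf : Measurable f) : (μ.withDensity fun a => f (T a)).map T = (μ.map T).withDensity f := by
  ext s hs
  rw [Measure.map_apply hT hs, withDensity_apply _ (hT hs), withDensity_apply _ hs,
    setLIntegral_map hs hf hT]

theorem absolutelyContinuous_fst_of_prod {μ μ' : Measure A} {ν ν' : Measure B} [SFinite ν]
    [SFinite ν'] [NeZero ν] (h : μ.prod ν ≪ μ'.prod ν') : μ ≪ μ' := fun s hs => by
  have : (μ.prod ν) (s ×ˢ Set.univ) = 0 := h (by rw [Measure.prod_prod, hs, zero_mul])
  simpa [NeZero.ne] using this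

theorem absolutelyContinuous_snd_of_prod {μ μ' : Measure A} {ν ν' : Measure B} [SFinite ν]
    [SFinite ν'] [NeZero μ] (h : μ.prod ν ≪ μ'.prod ν') : ν ≪ ν' := fun s hs => by
  have : (μ.prod ν) (Set.univ ×ˢ s) = 0 := h (by rw [Measure.prod_prod, hs, mul_zero])
  simpa [NeZero.ne] using this

theorem prod_eq_withDensity_rnDeriv_mul {μ μ' : Measure A} {ν ν' : Measure B} [SigmaFinite μ]
    [SFinite μ'] [SigmaFinite ν] [SFinite ν'] (hμ : μ' ≪ μ) (hν : ν' ≪ ν) :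
    μ'.prod ν' = (μ.prod ν).withDensity fun p => μ'.rnDeriv μ p.1 * ν'.rnDeriv ν p.2 := by
  rw [← prod_withDensity (Measure.measurable_rnDeriv _ _) (Measure.measurable_rnDeriv _ _),
    Measure.withDensity_rnDeriv_eq _ _ hμ, Measure.withDensity_rnDeriv_eq _ _ hν]

theorem ae_section_of_ae_prod {μ : Measure A} {ν : Measure B} {ρ : Measure C} [SFinite μ]
    [SFinite ν] [SFinite ρ] {r : A × B → Prop} {s : B × C → Prop}
    (hr : ∀ᵐ p ∂μ.prod ν, r p) (hs : ∀ᵐ p ∂ν.prod ρ, s p) :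
    ∀ᵐ p ∂μ.prod ρ, ∀ᵐ y ∂ν, r (p.1, y) ∧ s (y, p.2) := by
  have hr' := Measure.ae_ae_of_ae_prod hr
  have hs' := Measure.ae_ae_of_ae_prod
    (Measure.measurePreserving_swap.quasiMeasurePreserving.ae hs)
  filter_upwards [Measure.quasiMeasurePreserving_fst.ae hr',
    Measure.quasiMeasurePreserving_snd.ae hs'] with p hp hp'
  exact hp.and hp'

end Product

section Kernels

variable {X Y Z : Type*} [MeasurableSpace X] [MeasurableSpace Y] [MeasurableSpace Z]

/-- The kernel `(x, z) ↦ ∫ k₁(x, y) k₂(y, z) dν(y)` of the composition of the integral operators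
with the nonnegative kernels `k₁` and `k₂`. -/
def kernelComp (ν : Measure Y) (k₁ : X × Y → ℝ≥0∞) (k₂ : Y × Z → ℝ≥0∞) (p : X × Z) : ℝ≥0∞ :=
  ∫⁻ y, k₁ (p.1, y) * k₂ (y, p.2) ∂ν

/-- The density `(x, z) ↦ (∫ f₁(x, y)^{1/2} f₂(y, z)^{1/2} dν(y))²` of the half-density composition
of the measures with densities `f₁` and `f₂`. -/
def compDensity (ν : Measure Y) (f₁ : X × Y → ℝ≥0∞) (f₂ : Y × Z → ℝ≥0∞) (p : X × Z) : ℝ≥0∞ :=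
  kernelComp ν (fun q => f₁ q ^ (1 / 2 : ℝ)) (fun q => f₂ q ^ (1 / 2 : ℝ)) p ^ 2

variable (ν : Measure Y) [SFinite ν] {f₁ : X × Y → ℝ≥0∞} {f₂ : Y × Z → ℝ≥0∞}

theorem measurable_kernelComp (hf₁ : Measurable f₁) (hf₂ : Measurable f₂) :
    Measurable (kernelComp ν f₁ f₂) := by
  have : Measurable fun w : (X × Z) × Y => f₁ (w.1.1, w.2) * f₂ (w.2, w.1.2) := by fun_prop
  exact this.lintegral_prod_right'

theorem measurable_compDensity (hf₁ : Measurable f₁) (hf₂ : Measurable f₂) :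
    Measurable (compDensity ν f₁ f₂) :=
  (measurable_kernelComp ν (hf₁.pow_const _) (hf₂.pow_const _)).pow_const 2

end Kernels

/-- The density `f` (with respect to `κ`) splits as a product after the rotation
`(x, y) ↦ (x + y, x - y)`. For `κ` Gaussian, this is Bernstein's characterization of the Gaussian
measures in terms of densities. -/
def FactorsUnderAddSub {E : Type*} [AddCommGroup E] [MeasurableSpace E] (κ : Measure E)
    (f p q : E → ℝ≥0∞) : Prop :=
  ∀ᵐ w ∂κ.prod κ, f w.1 * f w.2 = p (w.1 + w.2) * q (w.1 - w.2)

namespace FactorsUnderAddSub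

section Powers

variable {E : Type*} [AddCommGroup E] [MeasurableSpace E] {κ : Measure E} {f p q : E → ℝ≥0∞}

theorem rpow (h : FactorsUnderAddSub κ f p q) {r : ℝ} (hr : 0 ≤ r) :
    FactorsUnderAddSub κ (fun x => f x ^ r) (fun x => p x ^ r) (fun x => q x ^ r) := by
  filter_upwards [h] with w hw
  simp only [← ENNReal.mul_rpow_of_nonneg _ _ hr, hw]

theorem pow (h : FactorsUnderAddSub κ f p q) (n : ℕ) :
    FactorsUnderAddSub κ (fun x => f x ^ n) (fun x => p x ^ n) (fun x => q x ^ n) := by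
  filter_upwards [h] with w hw
  simp only [← mul_pow, hw]

end Powers

section Measure

variable {E : Type*} [AddCommGroup E] [Module ℝ E] [MeasurableSpace E] [MeasurableAdd₂ E]
  [MeasurableSub₂ E] [MeasurableConstSMul ℝ E] {κ α β : Measure E} {f p q : E → ℝ≥0∞}

theorem measurePreserving [SFinite κ] [SFinite α] [SFinite β]
    (hκ : MeasurePreserving (addSub E) (κ.prod κ) (α.prod β)) (hf : Measurable f)
    (hp : Measurable p) (hq : Measurable q) (h : FactorsUnderAddSub κ f p q) :
    MeasurePreserving (addSub E) ((κ.withDensity f).prod (κ.withDensity f))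
      ((α.withDensity p).prod (β.withDensity q)) := by
  refine ⟨hκ.measurable, ?_⟩
  rw [prod_withDensity hf hf, prod_withDensity hp hq, ← hκ.map_eq,
    ← map_withDensity_comp _ hκ.measurable (by fun_prop), withDensity_congr_ae h]
  rfl

theorem exists_of_measurePreserving [SigmaFinite κ] [SigmaFinite α] [SigmaFinite β]
    (hκ : MeasurePreserving (addSub E) (κ.prod κ) (α.prod β)) (hf : Measurable f)
    {P Q : Measure E} [SFinite P] [SFinite Q] [NeZero P] [NeZero Q]
    (h : MeasurePreserving (addSub E) ((κ.withDensity f).prod (κ.withDensity f)) (P.prod Q)) :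
    ∃ p q : E → ℝ≥0∞, Measurable p ∧ Measurable q ∧ FactorsUnderAddSub κ f p q := by
  have ac_prod : P.prod Q ≪ α.prod β := by
    rw [← h.map_eq, ← hκ.map_eq, prod_withDensity hf hf]
    exact (withDensity_absolutelyContinuous _ _).map hκ.measurable
  have hp := Measure.measurable_rnDeriv P α
  have hq := Measure.measurable_rnDeriv Q β
  have prod_eq := prod_eq_withDensity_rnDeriv_mul (absolutelyContinuous_fst_of_prod ac_prod)
    (absolutelyContinuous_snd_of_prod ac_prod)
  have hpq : Measurable fun w : E × E => P.rnDeriv α w.1 * Q.rnDeriv β w.2 := by fun_prop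
  have map_eq := h.map_eq
  rw [prod_withDensity hf hf, prod_eq, ← hκ.map_eq,
    ← map_withDensity_comp _ hκ.measurable hpq] at map_eq
  exact ⟨_, _, hp, hq, (withDensity_eq_iff_of_sigmaFinite (by fun_prop)
    (hpq.comp hκ.measurable).aemeasurable).1 ((addSub E).map_measurableEquiv_injective map_eq)⟩

end Measure

section Composition

variable {X Y Z : Type*} [AddCommGroup X] [MeasurableSpace X] [AddCommGroup Z] [MeasurableSpace Z]
  [AddCommGroup Y] [Module ℝ Y] [MeasurableSpace Y] [MeasurableAdd₂ Y] [MeasurableSub₂ Y]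
  [MeasurableConstSMul ℝ Y] {μ : Measure X} {ρ : Measure Z} {ν α β : Measure Y} [SFinite μ]
  [SFinite ρ] [SFinite ν] [SFinite β] {k₁ a₁ b₁ : X × Y → ℝ≥0∞} {k₂ a₂ b₂ : Y × Z → ℝ≥0∞}

-- Fubini, followed by the substitution `(u, v) = (y + y', y - y')` in the double integral.
theorem kernelComp (hν : MeasurePreserving (addSub Y) (ν.prod ν) (α.prod β))
    (hk₁ : Measurable k₁) (hk₂ : Measurable k₂) (ha₁ : Measurable a₁) (ha₂ : Measurable a₂)
    (hb₁ : Measurable b₁) (hb₂ : Measurable b₂)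
    (h₁ : FactorsUnderAddSub (μ.prod ν) k₁ a₁ b₁) (h₂ : FactorsUnderAddSub (ν.prod ρ) k₂ a₂ b₂) :
    FactorsUnderAddSub (μ.prod ρ) (kernelComp ν k₁ k₂) (kernelComp α a₁ a₂)
      (kernelComp β b₁ b₂) := by
  have h₁' := (measurePreserving_prodProdProdComm μ μ ν ν).quasiMeasurePreserving.ae h₁
  have h₂' := (measurePreserving_prodProdProdComm ν ν ρ ρ).quasiMeasurePreserving.ae h₂
  filter_upwards [(measurePreserving_prodProdProdComm μ ρ μ ρ).quasiMeasurePreserving.ae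
    (ae_section_of_ae_prod h₁' h₂')] with w hw
  simp only [HalfDensities.kernelComp]
  rw [← lintegral_prod_mul (by fun_prop) (by fun_prop),
    ← lintegral_prod_mul (by fun_prop) (by fun_prop), ← hν.map_eq,
    lintegral_map (by fun_prop) hν.measurable]
  refine lintegral_congr_ae ?_
  filter_upwards [hw] with η hη
  have e₁ : k₁ (w.1.1, η.1) * k₁ (w.2.1, η.2) =
      a₁ (w.1.1 + w.2.1, η.1 + η.2) * b₁ (w.1.1 - w.2.1, η.1 - η.2) := hη.1
  have e₂ : k₂ (η.1, w.1.2) * k₂ (η.2, w.2.2) =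
      a₂ (η.1 + η.2, w.1.2 + w.2.2) * b₂ (η.1 - η.2, w.1.2 - w.2.2) := hη.2
  rw [mul_mul_mul_comm, e₁, e₂, mul_mul_mul_comm]
  rfl

theorem compDensity (hν : MeasurePreserving (addSub Y) (ν.prod ν) (α.prod β))
    (hk₁ : Measurable k₁) (hk₂ : Measurable k₂) (ha₁ : Measurable a₁) (ha₂ : Measurable a₂)
    (hb₁ : Measurable b₁) (hb₂ : Measurable b₂)
    (h₁ : FactorsUnderAddSub (μ.prod ν) k₁ a₁ b₁) (h₂ : FactorsUnderAddSub (ν.prod ρ) k₂ a₂ b₂) :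
    FactorsUnderAddSub (μ.prod ρ) (compDensity ν k₁ k₂) (compDensity α a₁ a₂)
      (compDensity β b₁ b₂) :=
  (kernelComp hν (hk₁.pow_const _) (hk₂.pow_const _) (ha₁.pow_const _) (ha₂.pow_const _)
    (hb₁.pow_const _) (hb₂.pow_const _) (h₁.rpow (by norm_num)) (h₂.rpow (by norm_num))).pow 2

end Composition

end FactorsUnderAddSub

section GaussianDensity

variable {X Y Z : Type*}
  [AddCommGroup X] [Module ℝ X] [TopologicalSpace X] [MeasurableSpace X] [CylinderMeasurableSpace X]
  [AddCommGroup Y] [Module ℝ Y] [TopologicalSpace Y] [MeasurableSpace Y] [CylinderMeasurableSpace Y]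
  [AddCommGroup Z] [Module ℝ Z] [TopologicalSpace Z] [MeasurableSpace Z] [CylinderMeasurableSpace Z]

theorem measurePreserving_addSub_prod {μ α β : Measure X} {ν α' β' : Measure Y} [SFinite μ]
    [SFinite α] [SFinite β] [SFinite ν] [SFinite α'] [SFinite β']
    (hμ : MeasurePreserving (addSub X) (μ.prod μ) (α.prod β))
    (hν : MeasurePreserving (addSub Y) (ν.prod ν) (α'.prod β')) :
    MeasurePreserving (addSub (X × Y)) ((μ.prod ν).prod (μ.prod ν))
      ((α.prod α').prod (β.prod β')) :=
  (measurePreserving_prodProdProdComm α β α' β').comp <|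
    (hμ.prod hν).comp (measurePreserving_prodProdProdComm μ ν μ ν)

theorem exists_measurePreserving_addSub_compDensity
    {μ : Measure X} {ν : Measure Y} {ρ : Measure Z} [IsGaussian μ] [IsGaussian ν] [IsGaussian ρ]
    {f₁ : X × Y → ℝ≥0∞} {f₂ : Y × Z → ℝ≥0∞} (hf₁ : Measurable f₁) (hf₂ : Measurable f₂)
    [IsGaussian ((μ.prod ν).withDensity f₁)] [IsGaussian ((ν.prod ρ).withDensity f₂)] :
    ∃ P Q : Measure (X × Z), SFinite P ∧ SFinite Q ∧ MeasurePreserving (addSub (X × Z))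
      (((μ.prod ρ).withDensity (compDensity ν f₁ f₂)).prod
        ((μ.prod ρ).withDensity (compDensity ν f₁ f₂))) (P.prod Q) := by
  obtain ⟨α, β, _, _, hμ⟩ := exists_measurePreserving_addSub_of_isGaussian μ
  obtain ⟨α', β', _, _, hν⟩ := exists_measurePreserving_addSub_of_isGaussian ν
  obtain ⟨α'', β'', _, _, hρ⟩ := exists_measurePreserving_addSub_of_isGaussian ρ
  obtain ⟨P₁, Q₁, _, _, h₁⟩ :=
    exists_measurePreserving_addSub_of_isGaussian ((μ.prod ν).withDensity f₁)
  obtain ⟨P₂, Q₂, _, _, h₂⟩ :=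
    exists_measurePreserving_addSub_of_isGaussian ((ν.prod ρ).withDensity f₂)
  obtain ⟨p₁, q₁, hp₁, hq₁, factors₁⟩ := FactorsUnderAddSub.exists_of_measurePreserving
    (measurePreserving_addSub_prod hμ hν) hf₁ h₁
  obtain ⟨p₂, q₂, hp₂, hq₂, factors₂⟩ := FactorsUnderAddSub.exists_of_measurePreserving
    (measurePreserving_addSub_prod hν hρ) hf₂ h₂
  exact ⟨_, _, inferInstance, inferInstance,
    (FactorsUnderAddSub.compDensity hν hf₁ hf₂ hp₁ hp₂ hq₁ hq₂ factors₁ factors₂).measurePreserving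
      (measurePreserving_addSub_prod hμ hρ) (measurable_compDensity ν hf₁ hf₂)
      (measurable_compDensity α' hp₁ hp₂) (measurable_compDensity β' hq₁ hq₂)⟩

end GaussianDensity

theorem rpow_one_half_sq (a : ℝ≥0∞) : (a ^ (1 / 2 : ℝ)) ^ 2 = a := by
  rw [← ENNReal.rpow_two, ← ENNReal.rpow_mul, one_div_mul_cancel two_ne_zero, ENNReal.rpow_one]

section CompDensity

variable {X Y Z : Type*} [MeasurableSpace X] [MeasurableSpace Y] [MeasurableSpace Z]
  {f₁ : X × Y → ℝ≥0∞} {f₂ : Y × Z → ℝ≥0∞}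

theorem compDensity_le (ν : Measure Y) (hf₁ : Measurable f₁) (hf₂ : Measurable f₂) (p : X × Z) :
    compDensity ν f₁ f₂ p ≤ (∫⁻ y, f₁ (p.1, y) ∂ν) * ∫⁻ y, f₂ (y, p.2) ∂ν := by
  have cauchy_schwarz := ENNReal.lintegral_mul_le_Lp_mul_Lq ν Real.HolderConjugate.two_two
    (f := fun y => f₁ (p.1, y) ^ (1 / 2 : ℝ)) (g := fun y => f₂ (y, p.2) ^ (1 / 2 : ℝ))
    (by fun_prop) (by fun_prop)
  simp only [ENNReal.rpow_two, rpow_one_half_sq] at cauchy_schwarz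
  calc compDensity ν f₁ f₂ p
      ≤ ((∫⁻ y, f₁ (p.1, y) ∂ν) ^ (1 / 2 : ℝ) * (∫⁻ y, f₂ (y, p.2) ∂ν) ^ (1 / 2 : ℝ)) ^ 2 :=
        pow_le_pow_left' cauchy_schwarz 2
    _ = (∫⁻ y, f₁ (p.1, y) ∂ν) * ∫⁻ y, f₂ (y, p.2) ∂ν := by
        rw [mul_pow, rpow_one_half_sq, rpow_one_half_sq]

variable {μ : Measure X} {ν : Measure Y} {ρ : Measure Z} [SFinite ν] [SFinite ρ]

theorem lintegral_compDensity_le (hf₁ : Measurable f₁) (hf₂ : Measurable f₂) :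
    ∫⁻ p, compDensity ν f₁ f₂ p ∂μ.prod ρ ≤
      (∫⁻ p, f₁ p ∂μ.prod ν) * ∫⁻ p, f₂ p ∂ν.prod ρ := by
  refine (lintegral_mono (compDensity_le ν hf₁ hf₂)).trans_eq ?_
  rw [lintegral_prod _ hf₁.aemeasurable, lintegral_prod_symm' _ hf₂, lintegral_prod_mul
    hf₁.lintegral_prod_right'.aemeasurable hf₂.lintegral_prod_left'.aemeasurable]

variable [SFinite μ]

theorem ae_compDensity_ne_zero [NeZero ν] (hf₁ : Measurable f₁) (hf₂ : Measurable f₂)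
    (hf₁_ne : ∀ᵐ p ∂μ.prod ν, f₁ p ≠ 0) (hf₂_ne : ∀ᵐ p ∂ν.prod ρ, f₂ p ≠ 0) :
    ∀ᵐ p ∂μ.prod ρ, compDensity ν f₁ f₂ p ≠ 0 := by
  filter_upwards [ae_section_of_ae_prod hf₁_ne hf₂_ne] with p hp h_zero
  rw [compDensity, pow_eq_zero_iff two_ne_zero, kernelComp,
    lintegral_eq_zero_iff (by fun_prop)] at h_zero
  obtain ⟨y, ⟨hy₁, hy₂⟩, hy⟩ := (hp.and h_zero).exists
  simp only [Pi.zero_apply, mul_eq_zero, ENNReal.rpow_eq_zero_iff_of_pos one_half_pos, hy₁, hy₂,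
    or_self] at hy

theorem ae_integral_mul_eq_toReal_kernelComp (hf₁ : Measurable f₁) (hf₂ : Measurable f₂)
    (hf₁_lt : ∀ᵐ p ∂μ.prod ν, f₁ p < ∞) (hf₂_lt : ∀ᵐ p ∂ν.prod ρ, f₂ p < ∞)
    {K₁ : X × Y → ℝ} {K₂ : Y × Z → ℝ} (hK₁ : K₁ =ᵐ[μ.prod ν] fun p => (f₁ p).toReal)
    (hK₂ : K₂ =ᵐ[ν.prod ρ] fun p => (f₂ p).toReal) :
    ∀ᵐ p ∂μ.prod ρ, ∫ y, K₁ (p.1, y) * K₂ (y, p.2) ∂ν = (kernelComp ν f₁ f₂ p).toReal := by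
  filter_upwards [ae_section_of_ae_prod hf₁_lt hf₂_lt, ae_section_of_ae_prod hK₁ hK₂] with p hp hK
  rw [kernelComp,
    ← integral_toReal (by fun_prop) (hp.mono fun y hy => ENNReal.mul_lt_top hy.1 hy.2)]
  refine integral_congr_ae ?_
  filter_upwards [hK] with y hy
  rw [hy.1, hy.2, ENNReal.toReal_mul]

theorem compDensity_ae_eq_of_withDensity {g₁ : X × Y → ℝ≥0∞} {g₂ : Y × Z → ℝ≥0∞} {h₁ : X → ℝ≥0∞}
    {h₂ : Y → ℝ≥0∞} {h₃ : Z → ℝ≥0∞} (hf₁ : Measurable f₁) (hf₂ : Measurable f₂)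
    (hh₂ : Measurable h₂) (hg₁ : g₁ =ᵐ[μ.prod ν] fun p => f₁ p * (h₁ p.1 * h₂ p.2))
    (hg₂ : g₂ =ᵐ[ν.prod ρ] fun p => f₂ p * (h₂ p.1 * h₃ p.2)) :
    compDensity ν g₁ g₂ =ᵐ[μ.prod ρ]
      fun p => (h₁ p.1 * h₃ p.2) * compDensity (ν.withDensity h₂) f₁ f₂ p := by
  filter_upwards [ae_section_of_ae_prod hg₁ hg₂] with p hp
  suffices kernelComp ν (fun q => g₁ q ^ (1 / 2 : ℝ)) (fun q => g₂ q ^ (1 / 2 : ℝ)) p =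
      (h₁ p.1 ^ (1 / 2 : ℝ) * h₃ p.2 ^ (1 / 2 : ℝ)) * kernelComp (ν.withDensity h₂)
        (fun q => f₁ q ^ (1 / 2 : ℝ)) (fun q => f₂ q ^ (1 / 2 : ℝ)) p by
    rw [compDensity, this, mul_pow, mul_pow, rpow_one_half_sq, rpow_one_half_sq, compDensity]
  rw [kernelComp, kernelComp, lintegral_withDensity_eq_lintegral_mul _ hh₂ (by fun_prop),
    ← lintegral_const_mul _ (by fun_prop)]
  refine lintegral_congr_ae ?_
  filter_upwards [hp] with y hy
  conv_rhs => rw [Pi.mul_apply, ← rpow_one_half_sq (h₂ y)]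
  simp only [hy.1, hy.2, ENNReal.mul_rpow_of_nonneg _ _ (one_half_pos (α := ℝ)).le]
  ring

end CompDensity

section ReferenceMeasure

variable {X Y Z : Type*} [MeasurableSpace X] [MeasurableSpace Y] [MeasurableSpace Z]

theorem rnDeriv_prod_ae_eq_mul {μ μ' : Measure X} {ν ν' : Measure Y} [SigmaFinite μ]
    [SigmaFinite μ'] [SigmaFinite ν] [SigmaFinite ν'] (hμ : μ' ≪ μ) (hν : ν' ≪ ν)
    {κ : Measure (X × Y)} [SigmaFinite κ] (hκ : κ ≪ μ'.prod ν') :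
    κ.rnDeriv (μ.prod ν) =ᵐ[μ.prod ν]
      fun p => κ.rnDeriv (μ'.prod ν') p * (μ'.rnDeriv μ p.1 * ν'.rnDeriv ν p.2) := by
  have rnDeriv_prod : (μ'.prod ν').rnDeriv (μ.prod ν) =ᵐ[μ.prod ν]
      fun p => μ'.rnDeriv μ p.1 * ν'.rnDeriv ν p.2 := by
    conv_lhs => rw [prod_eq_withDensity_rnDeriv_mul hμ hν]
    exact Measure.rnDeriv_withDensity _ (by fun_prop)
  filter_upwards [Measure.rnDeriv_mul_rnDeriv (κ := μ.prod ν) hκ, rnDeriv_prod] with p hp hp'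
  rw [← hp, Pi.mul_apply, hp']

theorem withDensity_compDensity_rnDeriv_eq {μ μ' : Measure X} {ν ν' : Measure Y} {ρ ρ' : Measure Z}
    [SigmaFinite μ] [SigmaFinite μ'] [SigmaFinite ν] [SigmaFinite ν'] [SigmaFinite ρ]
    [SigmaFinite ρ'] (hμ : μ' ≪ μ) (hν : ν' ≪ ν) (hρ : ρ' ≪ ρ) {κ₁ : Measure (X × Y)}
    {κ₂ : Measure (Y × Z)} [SigmaFinite κ₁] [SigmaFinite κ₂] (hκ₁ : κ₁ ≪ μ'.prod ν')
    (hκ₂ : κ₂ ≪ ν'.prod ρ') :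
    (μ'.prod ρ').withDensity
        (compDensity ν' (κ₁.rnDeriv (μ'.prod ν')) (κ₂.rnDeriv (ν'.prod ρ'))) =
      (μ.prod ρ).withDensity (compDensity ν (κ₁.rnDeriv (μ.prod ν)) (κ₂.rnDeriv (ν.prod ρ))) := by
  have m₁ := Measure.measurable_rnDeriv κ₁ (μ'.prod ν')
  have m₂ := Measure.measurable_rnDeriv κ₂ (ν'.prod ρ')
  have change_reference := compDensity_ae_eq_of_withDensity m₁ m₂ (Measure.measurable_rnDeriv ν' ν)
    (rnDeriv_prod_ae_eq_mul hμ hν hκ₁) (rnDeriv_prod_ae_eq_mul hν hρ hκ₂)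
  rw [Measure.withDensity_rnDeriv_eq _ _ hν] at change_reference
  rw [withDensity_congr_ae change_reference]
  conv_lhs => rw [prod_eq_withDensity_rnDeriv_mul hμ hρ]
  exact (withDensity_mul _ (by fun_prop) (measurable_compDensity ν' m₁ m₂)).symm

theorem lintegral_compDensity_rnDeriv_lt_top (μ : Measure X) (ν : Measure Y) (ρ : Measure Z)
    [SFinite ν] [SFinite ρ] (κ₁ : Measure (X × Y)) (κ₂ : Measure (Y × Z))
    [IsFiniteMeasure κ₁] [IsFiniteMeasure κ₂] :
    ∫⁻ p, compDensity ν (κ₁.rnDeriv (μ.prod ν)) (κ₂.rnDeriv (ν.prod ρ)) p ∂μ.prod ρ < ∞ :=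
  (lintegral_compDensity_le (Measure.measurable_rnDeriv _ _)
    (Measure.measurable_rnDeriv _ _)).trans_lt
    (ENNReal.mul_lt_top (Measure.lintegral_rnDeriv_lt_top _ _)
      (Measure.lintegral_rnDeriv_lt_top _ _))

end ReferenceMeasure

section Operators

variable {X : Type*} [MeasurableSpace X]

theorem ae_integral_mul_integral_eq {μ : Measure X} [SigmaFinite μ] {K₁ K₂ : X × X → ℝ}
    (hK₁ : MemLp K₁ 2 (μ.prod μ)) (hK₂ : MemLp K₂ 2 (μ.prod μ)) {f : X → ℝ} (hf : MemLp f 2 μ) :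
    ∀ᵐ x ∂μ, ∫ y, K₁ (x, y) * ∫ z, K₂ (y, z) * f z ∂μ ∂μ =
      ∫ z, (∫ y, K₁ (x, y) * K₂ (y, z) ∂μ) * f z ∂μ := by
  filter_upwards [ae_memLp_section hK₁] with x hx
  have integrable_uncurry :
      Integrable (fun p : X × X => K₁ (x, p.1) * (K₂ p * f p.2)) (μ.prod μ) := by
    refine (integrable_prod_iff (hx.1.comp_fst.mul (hK₂.1.mul hf.1.comp_snd))).2 ⟨?_, ?_⟩
    · filter_upwards [ae_memLp_section hK₂] with y hy
      exact (hy.integrable_mul hf).const_mul (K₁ (x, y))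
    · simp only [Pi.mul_apply, norm_mul, integral_const_mul]
      exact hx.norm.integrable_mul (memLp_kernel hK₂.norm hf.norm)
  calc ∫ y, K₁ (x, y) * ∫ z, K₂ (y, z) * f z ∂μ ∂μ
      = ∫ y, ∫ z, K₁ (x, y) * (K₂ (y, z) * f z) ∂μ ∂μ := by simp only [integral_const_mul]
    _ = ∫ z, ∫ y, K₁ (x, y) * (K₂ (y, z) * f z) ∂μ ∂μ :=
      integral_integral_swap integrable_uncurry
    _ = ∫ z, (∫ y, K₁ (x, y) * K₂ (y, z) ∂μ) * f z ∂μ := by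
      simp only [← mul_assoc, integral_mul_const]

theorem kernelOp_comp_eq {𝒞 : MeasureClass X} {K₁ K₂ K₃ : HalfDensity (𝒞.tensor 𝒞)}
    (h : ∀ μ : 𝒞.Rep, ∀ᵐ p ∂μ.1.prod μ.1, coord K₃ (μ.prod μ) p =
      ∫ y, coord K₁ (μ.prod μ) (p.1, y) * coord K₂ (μ.prod μ) (y, p.2) ∂μ.1) :
    kernelOp K₁ ∘ₗ kernelOp K₂ = kernelOp K₃ := by
  refine LinearMap.ext fun δ => Subtype.ext (funext fun μ => Lp.ext ?_)
  change kernelCoord K₁ (kernelOp K₂ δ) μ =ᵐ[μ.1] kernelCoord K₃ δ μ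
  filter_upwards [coeFn_kernelCoord K₁ (kernelOp K₂ δ) μ, coeFn_kernelCoord K₃ δ μ,
    Measure.ae_ae_of_ae_prod (h μ), ae_integral_mul_integral_eq (μ := μ.1)
      (Lp.memLp (coord K₁ (μ.prod μ))) (Lp.memLp (coord K₂ (μ.prod μ)))
      (Lp.memLp (coord δ μ))] with x h₁₂ h₃ h_coord h_swap
  rw [h₁₂, h₃]
  refine Eq.trans (integral_congr_ae ?_) (h_swap.trans (integral_congr_ae ?_))
  · filter_upwards [coeFn_kernelCoord K₂ δ μ] with y hy
    change _ * kernelCoord K₂ δ μ y = _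
    rw [hy]
  · filter_upwards [h_coord] with z hz
    rw [hz]

theorem coeFn_coord_sqrtMeasure {𝒞 : MeasureClass X} {ν : Measure X} [IsFiniteMeasure ν]
    (hν : ν ∈ 𝒞) (μ : 𝒞.Rep) : coord (sqrtMeasure ν hν) μ =ᵐ[μ.1] sqrtDeriv ν μ.1 :=
  (memLp_sqrtDeriv ν μ.1).coeFn_toLp

theorem sqrtDeriv_eq_toReal_rpow (ν μ : Measure X) (x : X) :
    sqrtDeriv ν μ x = (ν.rnDeriv μ x ^ (1 / 2 : ℝ)).toReal := by
  rw [sqrtDeriv, Real.sqrt_eq_rpow, ENNReal.toReal_rpow]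

end Operators

section Composition

variable {X : Type*} [MeasurableSpace X] {𝒞 : MeasureClass X} {ν₁ ν₂ ν₃ : Measure (X × X)}

/-- The half-density composition of `ν₁` and `ν₂`, as a measure built from their densities with
respect to the reference measure `μ × μ`. -/
def compMeasure (μ : Measure X) (ν₁ ν₂ : Measure (X × X)) : Measure (X × X) :=
  (μ.prod μ).withDensity
    (compDensity μ (ν₁.rnDeriv (μ.prod μ)) (ν₂.rnDeriv (μ.prod μ)))

theorem measurable_compDensity_rnDeriv (μ : Measure X) [SFinite μ] (ν₁ ν₂ : Measure (X × X)) :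
    Measurable (compDensity μ (ν₁.rnDeriv (μ.prod μ)) (ν₂.rnDeriv (μ.prod μ))) :=
  measurable_compDensity μ (Measure.measurable_rnDeriv _ _) (Measure.measurable_rnDeriv _ _)

variable [IsFiniteMeasure ν₁] [IsFiniteMeasure ν₂]

instance isFiniteMeasure_compMeasure (μ : Measure X) [SFinite μ] :
    IsFiniteMeasure (compMeasure μ ν₁ ν₂) :=
  isFiniteMeasure_withDensity (lintegral_compDensity_rnDeriv_lt_top μ μ μ ν₁ ν₂).ne

theorem compMeasure_eq_compMeasure (h₁ : ν₁ ∈ 𝒞.tensor 𝒞) (h₂ : ν₂ ∈ 𝒞.tensor 𝒞) (μ ρ : 𝒞.Rep) :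
    compMeasure μ.1 ν₁ ν₂ = compMeasure ρ.1 ν₁ ν₂ :=
  withDensity_compDensity_rnDeriv_eq (ac μ.2 ρ.2) (ac μ.2 ρ.2) (ac μ.2 ρ.2)
    (ac h₁ (μ.prod μ).2) (ac h₂ (μ.prod μ).2)

theorem compMeasure_mem_tensor (h₁ : ν₁ ∈ 𝒞.tensor 𝒞) (h₂ : ν₂ ∈ 𝒞.tensor 𝒞) (μ : 𝒞.Rep)
    [NeZero μ.1] : compMeasure μ.1 ν₁ ν₂ ∈ 𝒞.tensor 𝒞 := by
  have rnDeriv_ne_zero {ν : Measure (X × X)} [IsFiniteMeasure ν] (h : ν ∈ 𝒞.tensor 𝒞) :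
      ∀ᵐ p ∂μ.1.prod μ.1, ν.rnDeriv (μ.1.prod μ.1) p ≠ 0 :=
    (Measure.rnDeriv_pos' (ac (μ.prod μ).2 h)).mono fun p hp => hp.ne'
  exact ⟨inferInstance, μ.1, μ.2, μ.1, μ.2, withDensity_absolutelyContinuous _ _,
    withDensity_absolutelyContinuous' (measurable_compDensity_rnDeriv μ.1 ν₁ ν₂).aemeasurable
      (ae_compDensity_ne_zero (Measure.measurable_rnDeriv _ _) (Measure.measurable_rnDeriv _ _)
        (rnDeriv_ne_zero h₁) (rnDeriv_ne_zero h₂))⟩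

theorem ae_integral_coord_sqrtMeasure_mul_eq (h₁ : ν₁ ∈ 𝒞.tensor 𝒞) (h₂ : ν₂ ∈ 𝒞.tensor 𝒞)
    (μ : 𝒞.Rep) :
    ∀ᵐ p ∂μ.1.prod μ.1, ∫ η, coord (sqrtMeasure ν₁ h₁) (μ.prod μ) (p.1, η) *
        coord (sqrtMeasure ν₂ h₂) (μ.prod μ) (η, p.2) ∂μ.1 =
      (kernelComp μ.1 (fun q => ν₁.rnDeriv (μ.1.prod μ.1) q ^ (1 / 2 : ℝ))
        (fun q => ν₂.rnDeriv (μ.1.prod μ.1) q ^ (1 / 2 : ℝ)) p).toReal := by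
  have rpow_lt_top (ν : Measure (X × X)) [IsFiniteMeasure ν] :
      ∀ᵐ p ∂μ.1.prod μ.1, ν.rnDeriv (μ.1.prod μ.1) p ^ (1 / 2 : ℝ) < ∞ :=
    (ν.rnDeriv_lt_top _).mono fun p hp => ENNReal.rpow_lt_top_of_nonneg (by norm_num) hp.ne
  have coord_eq {ν : Measure (X × X)} [IsFiniteMeasure ν] (h : ν ∈ 𝒞.tensor 𝒞) :
      coord (sqrtMeasure ν h) (μ.prod μ) =ᵐ[μ.1.prod μ.1]
        fun p => (ν.rnDeriv (μ.1.prod μ.1) p ^ (1 / 2 : ℝ)).toReal :=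
    (coeFn_coord_sqrtMeasure h (μ.prod μ)).trans (.of_eq (funext (sqrtDeriv_eq_toReal_rpow _ _)))
  exact ae_integral_mul_eq_toReal_kernelComp (by fun_prop) (by fun_prop) (rpow_lt_top ν₁)
    (rpow_lt_top ν₂) (coord_eq h₁) (coord_eq h₂)

theorem ae_integral_coord_sqrtMeasure_mul_sq_eq (h₁ : ν₁ ∈ 𝒞.tensor 𝒞) (h₂ : ν₂ ∈ 𝒞.tensor 𝒞)
    (μ : 𝒞.Rep) :
    ∀ᵐ p ∂μ.1.prod μ.1, (∫ η, coord (sqrtMeasure ν₁ h₁) (μ.prod μ) (p.1, η) *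
        coord (sqrtMeasure ν₂ h₂) (μ.prod μ) (η, p.2) ∂μ.1) ^ 2 =
      (compDensity μ.1 (ν₁.rnDeriv (μ.1.prod μ.1)) (ν₂.rnDeriv (μ.1.prod μ.1)) p).toReal := by
  filter_upwards [ae_integral_coord_sqrtMeasure_mul_eq h₁ h₂ μ] with p hp
  rw [hp, compDensity, ENNReal.toReal_pow]

theorem IsComposition.eq_compMeasure {h₁ : ν₁ ∈ 𝒞.tensor 𝒞} {h₂ : ν₂ ∈ 𝒞.tensor 𝒞}
    (h : IsComposition 𝒞 ν₁ ν₂ h₁ h₂ ν₃) (μ : 𝒞.Rep) : ν₃ = compMeasure μ.1 ν₁ ν₂ := by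
  obtain ⟨_, h₃, -, hd⟩ := h
  rw [← Measure.withDensity_rnDeriv_eq ν₃ (μ.1.prod μ.1) (ac h₃ (μ.prod μ).2)]
  refine withDensity_congr_ae ?_
  filter_upwards [hd μ, ae_integral_coord_sqrtMeasure_mul_sq_eq h₁ h₂ μ,
    ν₃.rnDeriv_lt_top (μ.1.prod μ.1), ae_lt_top (measurable_compDensity_rnDeriv μ.1 ν₁ ν₂)
      (lintegral_compDensity_rnDeriv_lt_top μ.1 μ.1 μ.1 ν₁ ν₂).ne] with p hp hp' h_lt h_lt'
  exact (ENNReal.toReal_eq_toReal_iff' h_lt.ne h_lt'.ne).1 (hp.trans hp')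

theorem ae_rnDeriv_compMeasure_eq (h₁ : ν₁ ∈ 𝒞.tensor 𝒞) (h₂ : ν₂ ∈ 𝒞.tensor 𝒞) (μ ρ : 𝒞.Rep) :
    ∀ᵐ p ∂ρ.1.prod ρ.1, ((compMeasure μ.1 ν₁ ν₂).rnDeriv (ρ.1.prod ρ.1) p).toReal =
      (∫ η, coord (sqrtMeasure ν₁ h₁) (ρ.prod ρ) (p.1, η) *
        coord (sqrtMeasure ν₂ h₂) (ρ.prod ρ) (η, p.2) ∂ρ.1) ^ 2 := by
  rw [compMeasure_eq_compMeasure h₁ h₂ μ ρ]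
  filter_upwards [Measure.rnDeriv_withDensity _ (measurable_compDensity_rnDeriv ρ.1 ν₁ ν₂),
    ae_integral_coord_sqrtMeasure_mul_sq_eq h₁ h₂ ρ] with p hp hp'
  rw [hp', compMeasure, hp]

theorem isComposition_compMeasure (h₁ : ν₁ ∈ 𝒞.tensor 𝒞) (h₂ : ν₂ ∈ 𝒞.tensor 𝒞) (μ : 𝒞.Rep)
    [NeZero μ.1] : IsComposition 𝒞 ν₁ ν₂ h₁ h₂ (compMeasure μ.1 ν₁ ν₂) := by
  have h₃ := compMeasure_mem_tensor h₁ h₂ μ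
  have density_eq := ae_rnDeriv_compMeasure_eq h₁ h₂ μ
  refine ⟨inferInstance, h₃, kernelOp_comp_eq fun ρ => ?_, density_eq⟩
  filter_upwards [coeFn_coord_sqrtMeasure h₃ (ρ.prod ρ), density_eq ρ,
    ae_integral_coord_sqrtMeasure_mul_eq h₁ h₂ ρ] with p h_coord h_sq h_toReal
  have : sqrtDeriv (compMeasure μ.1 ν₁ ν₂) (ρ.1.prod ρ.1) p = _ := congrArg Real.sqrt h_sq
  exact h_coord.trans (this.trans (Real.sqrt_sq (h_toReal ▸ ENNReal.toReal_nonneg)))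

end Composition

section GaussianComposition

theorem exists_eq_smul_isGaussian_of_measurePreserving_addSub {E : Type*} [AddCommGroup E]
    [Module ℝ E] [TopologicalSpace E] [MeasurableSpace E] [CylinderMeasurableSpace E]
    {ν α β : Measure E} [IsFiniteMeasure ν] [NeZero ν] [SFinite α] [SFinite β]
    (h : MeasurePreserving (addSub E) (ν.prod ν) (α.prod β)) :
    ∃ (c : ℝ≥0) (G : Measure E), 0 < c ∧ IsGaussian G ∧ ν = c • G := by
  have h_ne : ν Set.univ ≠ 0 := NeZero.ne _
  have h_lt : ν Set.univ ≠ ∞ := measure_ne_top _ _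
  set c := (ν Set.univ)⁻¹
  have normalized : MeasurePreserving (addSub E) ((c • ν).prod (c • ν)) ((c • α).prod (c • β)) :=
    ⟨h.measurable, by simp only [Measure.prod_smul_left, Measure.prod_smul_right, Measure.map_smul,
      h.map_eq]⟩
  refine ⟨(ν Set.univ).toNNReal, c • ν, ENNReal.toNNReal_pos h_ne h_lt,
    isGaussian_of_measurePreserving_addSub normalized, ?_⟩
  rw [ENNReal.smul_def, ENNReal.coe_toNNReal h_lt, smul_smul, ENNReal.mul_inv_cancel h_ne h_lt,
    one_smul]

variable {X : Type*} [AddCommGroup X] [Module ℝ X] [TopologicalSpace X] [MeasurableSpace X]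
  [CylinderMeasurableSpace X]

theorem exists_measurePreserving_addSub_compMeasure {γ : Measure X} {ν₁ ν₂ : Measure (X × X)}
    [IsGaussian γ] [IsGaussian ν₁] [IsGaussian ν₂] (h₁ : ν₁ ≪ γ.prod γ) (h₂ : ν₂ ≪ γ.prod γ) :
    ∃ P Q : Measure (X × X), SFinite P ∧ SFinite Q ∧ MeasurePreserving (addSub (X × X))
      ((compMeasure γ ν₁ ν₂).prod (compMeasure γ ν₁ ν₂)) (P.prod Q) := by
  have : IsGaussian ((γ.prod γ).withDensity (ν₁.rnDeriv (γ.prod γ))) := by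
    rwa [Measure.withDensity_rnDeriv_eq _ _ h₁]
  have : IsGaussian ((γ.prod γ).withDensity (ν₂.rnDeriv (γ.prod γ))) := by
    rwa [Measure.withDensity_rnDeriv_eq _ _ h₂]
  exact exists_measurePreserving_addSub_compDensity (Measure.measurable_rnDeriv _ _)
    (Measure.measurable_rnDeriv _ _)

theorem IsComposition.exists_eq_smul_isGaussian {𝒞 : MeasureClass X} (γ : 𝒞.Rep) [IsGaussian γ.1]
    {ν₁ ν₂ ν₃ : Measure (X × X)} [IsGaussian ν₁] [IsGaussian ν₂] {h₁ : ν₁ ∈ 𝒞.tensor 𝒞}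
    {h₂ : ν₂ ∈ 𝒞.tensor 𝒞} (h : IsComposition 𝒞 ν₁ ν₂ h₁ h₂ ν₃) :
    ∃ (c : ℝ≥0) (G : Measure (X × X)), 0 < c ∧ IsGaussian G ∧ ν₃ = c • G := by
  obtain ⟨P, Q, _, _, hPQ⟩ := exists_measurePreserving_addSub_compMeasure
    (ac h₁ (γ.prod γ).2) (ac h₂ (γ.prod γ).2)
  rw [← h.eq_compMeasure γ] at hPQ
  obtain ⟨_, h₃, -⟩ := h
  have : NeZero ν₃ := ⟨fun h_zero => NeZero.ne (γ.1.prod γ.1)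
    (Measure.absolutelyContinuous_zero_iff.1 (h_zero ▸ ac (γ.prod γ).2 h₃))⟩
  exact exists_eq_smul_isGaussian_of_measurePreserving_addSub hPQ

end GaussianComposition

end HalfDensities

end

theorem propositionA15_general {X : Type*} [AddCommGroup X] [Module ℝ X] [TopologicalSpace X]
    [mX : MeasurableSpace X]
    (hX : mX = HalfDensities.cylinderSigmaAlgebra X)
    (𝒞 : HalfDensities.MeasureClass X)
    (h𝒞 : ∃ γ : MeasureTheory.Measure X, ProbabilityTheory.IsGaussian γ ∧ γ ∈ 𝒞)
    (ν₁ ν₂ : MeasureTheory.Measure (X × X))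
    [ProbabilityTheory.IsGaussian ν₁] [ProbabilityTheory.IsGaussian ν₂]
    (h₁ : ν₁ ∈ 𝒞.tensor 𝒞) (h₂ : ν₂ ∈ 𝒞.tensor 𝒞) :
    (∃ ν₃ : MeasureTheory.Measure (X × X), HalfDensities.IsComposition 𝒞 ν₁ ν₂ h₁ h₂ ν₃) ∧
    ∀ ν₃ : MeasureTheory.Measure (X × X), HalfDensities.IsComposition 𝒞 ν₁ ν₂ h₁ h₂ ν₃ →
      ∃ (c : NNReal) (G : MeasureTheory.Measure (X × X)),
        0 < c ∧ ProbabilityTheory.IsGaussian G ∧ ν₃ = c • G := by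
  have : HalfDensities.CylinderMeasurableSpace X := ⟨hX⟩
  obtain ⟨γ, _, hγ⟩ := h𝒞
  let γ' : 𝒞.Rep := ⟨γ, hγ⟩
  have : ProbabilityTheory.IsGaussian γ'.1 := ‹_›
  exact ⟨⟨_, HalfDensities.isComposition_compMeasure h₁ h₂ γ'⟩,
    fun ν₃ h => h.exists_eq_smul_isGaussian γ'⟩

theorem propositionA15 {X : Type*} [AddCommGroup X] [Module ℝ X] [TopologicalSpace X]
    [IsTopologicalAddGroup X] [ContinuousSMul ℝ X] [LocallyConvexSpace ℝ X]
    [mX : MeasurableSpace X] [StandardBorelSpace X]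
    (hX : mX = HalfDensities.cylinderSigmaAlgebra X)
    (𝒞 : HalfDensities.MeasureClass X)
    (h𝒞 : ∃ γ : MeasureTheory.Measure X, ProbabilityTheory.IsGaussian γ ∧ γ ∈ 𝒞)
    (ν₁ ν₂ : MeasureTheory.Measure (X × X))
    [ProbabilityTheory.IsGaussian ν₁] [ProbabilityTheory.IsGaussian ν₂]
    (h₁ : ν₁ ∈ 𝒞.tensor 𝒞) (h₂ : ν₂ ∈ 𝒞.tensor 𝒞) :
    (∃ ν₃ : MeasureTheory.Measure (X × X), HalfDensities.IsComposition 𝒞 ν₁ ν₂ h₁ h₂ ν₃) ∧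
    ∀ ν₃ : MeasureTheory.Measure (X × X), HalfDensities.IsComposition 𝒞 ν₁ ν₂ h₁ h₂ ν₃ →
      ∃ (c : NNReal) (G : MeasureTheory.Measure (X × X)),
        0 < c ∧ ProbabilityTheory.IsGaussian G ∧ ν₃ = c • G :=
  propositionA15_general hX 𝒞 h𝒞 ν₁ ν₂ h₁ h₂
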